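/- Let $\Bbbk$ be an algebraically closed field of characteristic $0$, let $n\ge 2$ and $0\le t\le n-1$ be integers, and let $\xi\in\Bbbk$ be a primitive $n$-th root of unity. Let $H=H(n,t,\xi)$ be the Hopf algebra generated as a $\Bbbk$-algebra by $g$ and $x$ subject to $g^n=1$ and $xg=\xi gx$, with $$\Delta(g)=g\otimes g,\quad \Delta(x)=x\otimes g^t+1\otimes x,\quad \varepsilon(g)=1,\quad \varepsilon(x)=0,\quad S(g)=g^{-1},\quad S(x)=-xg^{-t}.$$ A Yetter–Drinfeld module over $H$ is a left $H$-module and left $H$-comodule $V$ with $\delta(h\cdot v)=h_{(1)}v_{(-1)}S(h_{(3)})\otimes h_{(2)}\cdot v_{(0)}$ for all $h\in H$, $v\in V$; isomorphisms are the linear isomorphisms that preserve the action and the coaction. Let $N$ be the order of $\xi^t$. For $a\in\mathbb Z$ let $\phi(a)$ be the integer in $\{1,\dots,N\}$ with $\phi(a)\equiv a \pmod N$. Let $\mathcal J=\{i\in\mathbb Z \mid i\not\equiv tk \pmod n \text{ for all } k\in\mathbb Z\}$. For $i,j\in\mathbb Z$ define $c_j^i(k,l)\in H$ for $0\le l\le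 k$ by $c_j^i(0,0)=g^i$ and, for $k\ge 0$, $$c_j^i(k+1,l)=\begin{cases} c_j^i(k,0)S(x)+\xi^{tj}\,x\,c_j^i(k,0)S(g^t), & l=0,\\ c_j^i(k,l)S(x)+\xi^{t(j-l)}\,x\,c_j^i(k,l)S(g^t)+c_j^i(k,l-1)S(g^t), & 0<l<k+1,\\ c_j^i(k,k)S(g^t), & l=k+1.\end{cases}$$ For $i,j\in\mathbb Z$ and $\lambda\in\Bbbk$, let $V(ti,j,\lambda)$ be the vector space with basis $v_0,\dots,v_m$, where $m=N-\phi(-i-j)$ if $\lambda=0$ and $m=n-1$ if $\lambda\ne 0$, with $$g\cdot v_k=\xi^{j-k}v_k,\qquad x\cdot v_k=v_{k+1}\ (k<m),\qquad x\cdot v_m=\lambda v_0,\qquad \delta(v_k)=\sum_{l=0}^k c_j^{ti}(k,l)\otimes v_l .$$ For $i\in\mathcal J$ and $j\in\mathbb Z$, let $V(i,j)$ be the vector space with basis $v_0,v_1,v_2,\dots$, with $$g\cdot v_k=\xi^{j-k}v_k,\qquad x\cdot v_k=v_{k+1},\qquad \delta(v_k)=\sum_{l=0}^k c_j^{i}(k,l)\otimes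 v_l .$$ Then: 1. For all $i,j\in\mathbb Z$ and $\lambda\in\Bbbk$, $V(ti,j,\lambda)$ is a (finite-dimensional) simple Yetter–Drinfeld module over $H$, and every finite-dimensional simple Yetter–Drinfeld module over $H$ is isomorphic to one of these. 2. $H$ has an infinite-dimensional simple Yetter–Drinfeld module if and only if $t$ and $n$ are not coprime. For all $i\in\mathcal J$ and $j\in\mathbb Z$, $V(i,j)$ is an (infinite-dimensional) simple Yetter–Drinfeld module over $H$, and every infinite-dimensional simple Yetter–Drinfeld module over $H$ is isomorphic to one of these. 3. The isomorphisms between these modules are as follows. - If $V(ti,j,\lambda)\cong V(tr,s,\mu)$, then $\lambda=\mu$. - $V(ti,j,0)\cong V(tr,s,0)$ if and only if $i\equiv r \pmod N$ and $j\equiv s\pmod n$. - Let $\lambda\neq 0$ and $p=N-\phi(-i-j)+1$. If $p=N$, then $V(ti,j,\lambda)\cong V(tr,s,\lambda)$ if and only if $i\equiv r$ and $j\equiv s \pmod N$. If $p<N$, then $V(ti,j,\lambda)\cong V(tr,s,\lambda)$ if and only if either $i\equiv r$ and $j\equiv s\pmod N$, or $r\equiv i-p$ and $s\equiv j-p\pmod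 N$. - For $i,r\in\mathcal J$ and $j,s\in\mathbb Z$, $V(i,j)\cong V(r,s)$ if and only if $i\equiv r$ and $j\equiv s\pmod n$. -/

import Mathlib

open scoped TensorProduct

universe u v w

noncomputable section

namespace InfTaft

/-! ### The Hopf algebra `H(n, t, ξ)` -/

/-- The two generators `g` and `x`. -/
inductive Gen : Type
  | g : Gen
  | x : Gen

/-- The defining relations `g ^ n = 1` and `x g = ξ g x`. -/
inductive Rel (k : Type u) [Field k] (n : ℕ) (ξ : k) :
    FreeAlgebra k Gen → FreeAlgebra k Gen → Prop
  | pow : Rel k n ξ (FreeAlgebra.ι k Gen.g ^ n) 1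
  | comm : Rel k n ξ (FreeAlgebra.ι k Gen.x * FreeAlgebra.ι k Gen.g)
      (ξ • (FreeAlgebra.ι k Gen.g * FreeAlgebra.ι k Gen.x))

/-- The underlying algebra of the infinite-dimensional Taft algebra: the `k`-algebra generated by
`g` and `x` subject to `g ^ n = 1` and `x g = ξ g x`. The parameter `t` only enters the coalgebra
structure and the antipode, defined below. -/
def Taft {k : Type u} [Field k] (n _t : ℕ) (ξ : k) : Type u := RingQuot (Rel k n ξ)

section Algebra

variable {k : Type u} [Field k] (n t : ℕ) (ξ : k)

instance : Ring (Taft n t ξ) := inferInstanceAs (Ring (RingQuot (Rel k n ξ)))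

instance : Algebra k (Taft n t ξ) := inferInstanceAs (Algebra k (RingQuot (Rel k n ξ)))

/-- The quotient map from the free algebra. -/
def mk : FreeAlgebra k Gen →ₐ[k] Taft n t ξ := RingQuot.mkAlgHom k (Rel k n ξ)

/-- The generator `g`. -/
def g : Taft n t ξ := mk n t ξ (FreeAlgebra.ι k Gen.g)

/-- The generator `x`. -/
def x : Taft n t ξ := mk n t ξ (FreeAlgebra.ι k Gen.x)

theorem g_pow : g n t ξ ^ n = 1 := by
  have h := RingQuot.mkAlgHom_rel k (Rel.pow (k := k) (n := n) (ξ := ξ))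
  rw [map_pow, map_one] at h
  exact h

theorem x_mul_g : x n t ξ * g n t ξ = ξ • (g n t ξ * x n t ξ) := by
  have h := RingQuot.mkAlgHom_rel k (Rel.comm (k := k) (n := n) (ξ := ξ))
  rw [map_mul, map_smul, map_mul] at h
  exact h

variable {n ξ}

/-- The universal property: a pair of elements satisfying the defining relations gives an algebra
map out of `H(n, t, ξ)`. -/
def lift {A : Type v} [Ring A] [Algebra k A] (G X : A) (hG : G ^ n = 1)
    (hX : X * G = ξ • (G * X)) : Taft n t ξ →ₐ[k] A :=
  RingQuot.liftAlgHom k ⟨FreeAlgebra.lift k (fun a : Gen => Gen.rec G X a), by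
    intro a b h
    cases h with
    | pow => simpa using hG
    | comm => simpa using hX⟩

@[simp]
theorem lift_g {A : Type v} [Ring A] [Algebra k A] (G X : A) (hG : G ^ n = 1)
    (hX : X * G = ξ • (G * X)) : lift t G X hG hX (g n t ξ) = G := by
  have h : lift t G X hG hX (g n t ξ) = FreeAlgebra.lift k (fun a : Gen => (Gen.rec G X a : A))
      (FreeAlgebra.ι k Gen.g) := RingQuot.liftAlgHom_mkAlgHom_apply _ _ _ _
  simpa using h

@[simp]
theorem lift_x {A : Type v} [Ring A] [Algebra k A] (G X : A) (hG : G ^ n = 1)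
    (hX : X * G = ξ • (G * X)) : lift t G X hG hX (x n t ξ) = X := by
  have h : lift t G X hG hX (x n t ξ) = FreeAlgebra.lift k (fun a : Gen => (Gen.rec G X a : A))
      (FreeAlgebra.ι k Gen.x) := RingQuot.liftAlgHom_mkAlgHom_apply _ _ _ _
  simpa using h

theorem algHom_ext {A : Type v} [Ring A] [Algebra k A] {φ ψ : Taft n t ξ →ₐ[k] A}
    (hg : φ (g n t ξ) = ψ (g n t ξ)) (hx : φ (x n t ξ) = ψ (x n t ξ)) : φ = ψ := by
  apply RingQuot.ringQuot_ext' k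
  apply FreeAlgebra.hom_ext
  funext a
  cases a
  · exact hg
  · exact hx

theorem induction_taft {P : Taft n t ξ → Prop} (hc : ∀ c : k, P (algebraMap k _ c))
    (hg : P (g n t ξ)) (hx : P (x n t ξ)) (ha : ∀ a b, P a → P b → P (a + b))
    (hm : ∀ a b, P a → P b → P (a * b)) (a : Taft n t ξ) : P a := by
  obtain ⟨b, rfl⟩ := RingQuot.mkAlgHom_surjective k (Rel k n ξ) a
  change P (mk n t ξ b)
  induction b using FreeAlgebra.induction with
  | grade0 c => rw [AlgHom.commutes]; exact hc c
  | grade1 a =>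
    cases a
    · exact hg
    · exact hx
  | mul a b h1 h2 => rw [map_mul]; exact hm _ _ h1 h2
  | add a b h1 h2 => rw [map_add]; exact ha _ _ h1 h2

end Algebra

section Hopf

variable {k : Type u} [Field k] (n t : ℕ) (ξ : k)

/-- The comultiplication: `Δ(g) = g ⊗ g` and `Δ(x) = x ⊗ g ^ t + 1 ⊗ x`. -/
def comulHom : Taft n t ξ →ₐ[k] Taft n t ξ ⊗[k] Taft n t ξ :=
  lift t (g n t ξ ⊗ₜ[k] g n t ξ) (x n t ξ ⊗ₜ[k] (g n t ξ ^ t) + 1 ⊗ₜ[k] x n t ξ)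
    (by rw [Algebra.TensorProduct.tmul_pow, g_pow, Algebra.TensorProduct.one_def])
    (by
      simp only [add_mul, mul_add, Algebra.TensorProduct.tmul_mul_tmul, x_mul_g, one_mul, mul_one,
        smul_add, TensorProduct.smul_tmul', TensorProduct.tmul_smul, ← pow_succ, ← pow_succ'])

/-- The counit: `ε(g) = 1` and `ε(x) = 0`. -/
def counitHom : Taft n t ξ →ₐ[k] k :=
  lift t 1 0 (one_pow n) (by simp)

instance : Bialgebra k (Taft n t ξ) :=
  Bialgebra.ofAlgHom (comulHom n t ξ) (counitHom n t ξ)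
    (by
      apply algHom_ext
      · simp [comulHom]
      · simp [comulHom, TensorProduct.add_tmul, TensorProduct.tmul_add, add_assoc,
          Algebra.TensorProduct.one_def])
    (by apply algHom_ext <;> simp [comulHom, counitHom])
    (by apply algHom_ext <;> simp [comulHom, counitHom])

variable [NeZero n]

/-- The generator `g` as an invertible element, so that `g ^ i` makes sense for `i : ℤ`. -/
def gUnit : (Taft n t ξ)ˣ := Units.ofPowEqOne (g n t ξ) n (g_pow n t ξ) (NeZero.ne n)

/-- The element `g ^ i` of `H(n, t, ξ)`, for an integer `i`. -/
def gz (i : ℤ) : Taft n t ξ := ((gUnit n t ξ ^ i : (Taft n t ξ)ˣ) : Taft n t ξ)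

theorem gz_one : gz n t ξ 1 = g n t ξ := by simp [gz, gUnit]

theorem gz_natCast (m : ℕ) : gz n t ξ m = g n t ξ ^ m := by simp [gz, gUnit]

theorem gz_add (i j : ℤ) : gz n t ξ (i + j) = gz n t ξ i * gz n t ξ j := by
  simp [gz, zpow_add]

theorem gz_zero : gz n t ξ 0 = 1 := by simp [gz]

theorem gz_neg_mul_self (i : ℤ) : gz n t ξ (-i) * gz n t ξ i = 1 := by
  rw [← gz_add, neg_add_cancel, gz_zero]

theorem gz_mul_neg_self (i : ℤ) : gz n t ξ i * gz n t ξ (-i) = 1 := by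
  rw [← gz_add, add_neg_cancel, gz_zero]

theorem gz_neg_one_mul_x :
    gz n t ξ (-1) * x n t ξ = ξ • (x n t ξ * gz n t ξ (-1)) := by
  have h : gz n t ξ (-1) * (x n t ξ * g n t ξ) * gz n t ξ (-1) =
      gz n t ξ (-1) * (ξ • (g n t ξ * x n t ξ)) * gz n t ξ (-1) := by rw [x_mul_g]
  have h1 := gz_mul_neg_self n t ξ 1
  have h2 := gz_neg_mul_self n t ξ 1
  rw [gz_one] at h1 h2
  rw [mul_assoc, mul_assoc, h1, mul_one, mul_smul_comm, ← mul_assoc (gz n t ξ (-1)), h2,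
    one_mul, smul_mul_assoc] at h
  exact h

/-- The antipode as an algebra map to the opposite algebra: `S(g) = g⁻¹`, `S(x) = - x g ^ (-t)`. -/
def antipodeHom : Taft n t ξ →ₐ[k] (Taft n t ξ)ᵐᵒᵖ :=
  lift t (MulOpposite.op (gz n t ξ (-1))) (MulOpposite.op (-(x n t ξ * gz n t ξ (-(t : ℤ)))))
    (by
      rw [← MulOpposite.op_pow, MulOpposite.op_eq_one_iff]
      have h : (gUnit n t ξ) ^ n = 1 := by
        ext; simpa [gUnit] using g_pow n t ξ
      have h' : (gUnit n t ξ ^ (-1 : ℤ)) ^ n = 1 := by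
        rw [zpow_neg, zpow_one, inv_pow, h, inv_one]
      simpa [gz] using congrArg Units.val h')
    (by
      rw [← MulOpposite.op_mul, ← MulOpposite.op_mul, ← MulOpposite.op_smul]
      congr 1
      rw [mul_neg, neg_mul, smul_neg, ← mul_assoc, gz_neg_one_mul_x, smul_mul_assoc, mul_assoc,
        mul_assoc, ← gz_add, ← gz_add, add_comm])

/-- The antipode of `H(n, t, ξ)`. -/
def antipodeLin : Taft n t ξ →ₗ[k] Taft n t ξ :=
  (MulOpposite.opLinearEquiv k).symm.toLinearMap ∘ₗ (antipodeHom n t ξ).toLinearMap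

theorem antipodeLin_mul (a b : Taft n t ξ) :
    antipodeLin n t ξ (a * b) = antipodeLin n t ξ b * antipodeLin n t ξ a := by
  simp [antipodeLin]

theorem antipodeLin_algebraMap (c : k) :
    antipodeLin n t ξ (algebraMap k _ c) = algebraMap k _ c := by
  simp [antipodeLin]

theorem antipodeLin_one : antipodeLin n t ξ 1 = 1 := by
  simp [antipodeLin]

theorem antipodeLin_g : antipodeLin n t ξ (g n t ξ) = gz n t ξ (-1) := by
  simp [antipodeLin, antipodeHom]

theorem antipodeLin_x :
    antipodeLin n t ξ (x n t ξ) = -(x n t ξ * gz n t ξ (-(t : ℤ))) := by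
  simp [antipodeLin, antipodeHom]

theorem antipodeLin_g_pow (m : ℕ) :
    antipodeLin n t ξ (g n t ξ ^ m) = gz n t ξ (-(m : ℤ)) := by
  induction m with
  | zero => simp [antipodeLin_one, gz_zero]
  | succ m ih =>
    rw [pow_succ, antipodeLin_mul, ih, antipodeLin_g, ← gz_add]
    congr 1
    push_cast
    ring

theorem comul_g : Coalgebra.comul (R := k) (g n t ξ) = g n t ξ ⊗ₜ[k] g n t ξ := by
  change comulHom n t ξ (g n t ξ) = _
  simp [comulHom]

theorem comul_x : Coalgebra.comul (R := k) (x n t ξ) =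
    x n t ξ ⊗ₜ[k] (g n t ξ ^ t) + 1 ⊗ₜ[k] x n t ξ := by
  change comulHom n t ξ (x n t ξ) = _
  simp [comulHom]

theorem counit_g : Coalgebra.counit (R := k) (g n t ξ) = 1 := by
  change counitHom n t ξ (g n t ξ) = _
  simp [counitHom]

theorem counit_x : Coalgebra.counit (R := k) (x n t ξ) = 0 := by
  change counitHom n t ξ (x n t ξ) = _
  simp [counitHom]

theorem left_aux (u : Taft n t ξ ⊗[k] Taft n t ξ) (a b : Taft n t ξ) :
    LinearMap.mul' k _ ((antipodeLin n t ξ).rTensor _ (u * a ⊗ₜ[k] b)) =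
      antipodeLin n t ξ a * LinearMap.mul' k _ ((antipodeLin n t ξ).rTensor _ u) * b := by
  induction u using TensorProduct.induction_on with
  | zero => simp
  | tmul c d => simp [antipodeLin_mul, mul_assoc]
  | add p q hp hq => simp only [add_mul, map_add, mul_add, hp, hq]

theorem left_mul (u v : Taft n t ξ ⊗[k] Taft n t ξ) (c : k)
    (h : LinearMap.mul' k _ ((antipodeLin n t ξ).rTensor _ u) = algebraMap k _ c) :
    LinearMap.mul' k _ ((antipodeLin n t ξ).rTensor _ (u * v)) =
      algebraMap k _ c * LinearMap.mul' k _ ((antipodeLin n t ξ).rTensor _ v) := by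
  induction v using TensorProduct.induction_on with
  | zero => simp
  | tmul a b =>
    rw [left_aux, h, ← Algebra.commutes]
    simp [mul_assoc]
  | add p q hp hq => simp only [mul_add, map_add, hp, hq]

theorem right_aux (v : Taft n t ξ ⊗[k] Taft n t ξ) (a b : Taft n t ξ) :
    LinearMap.mul' k _ ((antipodeLin n t ξ).lTensor _ (a ⊗ₜ[k] b * v)) =
      a * LinearMap.mul' k _ ((antipodeLin n t ξ).lTensor _ v) * antipodeLin n t ξ b := by
  induction v using TensorProduct.induction_on with
  | zero => simp
  | tmul c d => simp [antipodeLin_mul, mul_assoc]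
  | add p q hp hq => simp only [add_mul, map_add, mul_add, hp, hq]

theorem right_mul (u v : Taft n t ξ ⊗[k] Taft n t ξ) (c : k)
    (h : LinearMap.mul' k _ ((antipodeLin n t ξ).lTensor _ v) = algebraMap k _ c) :
    LinearMap.mul' k _ ((antipodeLin n t ξ).lTensor _ (u * v)) =
      LinearMap.mul' k _ ((antipodeLin n t ξ).lTensor _ u) * algebraMap k _ c := by
  induction u using TensorProduct.induction_on with
  | zero => simp
  | tmul a b =>
    rw [right_aux, h, mul_assoc, Algebra.commutes]
    simp [mul_assoc]
  | add p q hp hq => simp only [add_mul, map_add, hp, hq]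

/-- The Hopf algebra `H(n, t, ξ)`. -/
instance : HopfAlgebra k (Taft n t ξ) where
  antipode := antipodeLin n t ξ
  mul_antipode_rTensor_comul := by
    refine LinearMap.ext fun a => ?_
    change LinearMap.mul' k _ ((antipodeLin n t ξ).rTensor _ (Coalgebra.comul (R := k) a)) =
      algebraMap k _ (Coalgebra.counit (R := k) a)
    induction a using induction_taft with
    | hc c => simp [antipodeLin_algebraMap]
    | hg =>
      have h := gz_neg_mul_self n t ξ 1
      rw [gz_one] at h
      simp [comul_g, counit_g, antipodeLin_g, h]
    | hx =>
      have h := gz_neg_mul_self n t ξ t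
      rw [gz_natCast] at h
      simp [comul_x, counit_x, antipodeLin_x, antipodeLin_one, mul_assoc, h]
    | ha a b h1 h2 => simp only [map_add, h1, h2]
    | hm a b h1 h2 =>
      rw [Bialgebra.comul_mul, left_mul n t ξ _ _ _ h1, h2, Bialgebra.counit_mul, map_mul]
  mul_antipode_lTensor_comul := by
    refine LinearMap.ext fun a => ?_
    change LinearMap.mul' k _ ((antipodeLin n t ξ).lTensor _ (Coalgebra.comul (R := k) a)) =
      algebraMap k _ (Coalgebra.counit (R := k) a)
    induction a using induction_taft with
    | hc c => simp [antipodeLin_one]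
    | hg =>
      have h := gz_mul_neg_self n t ξ 1
      rw [gz_one] at h
      simp [comul_g, counit_g, antipodeLin_g, h]
    | hx => simp [comul_x, counit_x, antipodeLin_x, antipodeLin_g_pow]
    | ha a b h1 h2 => simp only [map_add, h1, h2]
    | hm a b h1 h2 =>
      rw [Bialgebra.comul_mul, right_mul n t ξ _ _ _ h2, h1, Bialgebra.counit_mul, map_mul]

end Hopf

end InfTaft

/-! ### Yetter-Drinfeld modules over a Hopf algebra -/

section YD

variable (k : Type u) [Field k] (H : Type v) [Ring H] [HopfAlgebra k H]

/-- A left `H`-module structure on `V` (an algebra map `H → End V`) together with a linear map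
`δ : V → H ⊗ V`. The laws that make it a Yetter-Drinfeld module are in `IsYetterDrinfeld`. -/
structure YDData (V : Type w) [AddCommGroup V] [Module k V] where
  /-- The action of `H`. -/
  act : H →ₐ[k] Module.End k V
  /-- The map `δ`. -/
  coact : V →ₗ[k] H ⊗[k] V

variable {k H}

namespace YDData

variable {V : Type w} [AddCommGroup V] [Module k V]

/-- The linear map `H ⊗ (H ⊗ H) → End (H ⊗ V)` that sends `a ⊗ (b ⊗ c)` to the endomorphism
`y ⊗ v ↦ a y S(c) ⊗ b • v`; see `twist_tmul`. -/
def twist (M : YDData k H V) : H ⊗[k] (H ⊗[k] H) →ₗ[k] Module.End k (H ⊗[k] V) :=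
  TensorProduct.lift
      ((TensorProduct.mapBilinear (RingHom.id k) H V H V).flip.compl₁₂ M.act.toLinearMap
        (LinearMap.mul' k (Module.End k H) ∘ₗ
          TensorProduct.map (LinearMap.mul k H)
            ((LinearMap.mul k H).flip ∘ₗ HopfAlgebra.antipode k))) ∘ₗ
    (TensorProduct.leftComm k H H H).toLinearMap

theorem twist_tmul (M : YDData k H V) (a b c y : H) (z : V) :
    M.twist (a ⊗ₜ[k] (b ⊗ₜ[k] c)) (y ⊗ₜ[k] z) =
      (a * y * HopfAlgebra.antipode k c) ⊗ₜ[k] M.act b z := by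
  simp [twist, mul_assoc]

/-- The laws of a (left-left) Yetter-Drinfeld module over `H`: `δ` is a coassociative and counital
left coaction, and `δ(h • v) = h₁ v₋₁ S(h₃) ⊗ h₂ • v₀` for all `h` and `v`. -/
structure IsYetterDrinfeld (M : YDData k H V) : Prop where
  coassoc : (TensorProduct.assoc k H H V).toLinearMap ∘ₗ
      (Coalgebra.comul (R := k) (A := H)).rTensor V ∘ₗ M.coact = M.coact.lTensor H ∘ₗ M.coact
  counit : (TensorProduct.lid k V).toLinearMap ∘ₗ
      (Coalgebra.counit (R := k) (A := H)).rTensor V ∘ₗ M.coact = LinearMap.id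
  compat : ∀ (h : H) (z : V), M.coact (M.act h z) =
      M.twist ((Coalgebra.comul (R := k) (A := H)).lTensor H (Coalgebra.comul (R := k) h))
        (M.coact z)

/-- `W` is a Yetter-Drinfeld submodule: it is stable under the action, and `δ(W) ⊆ H ⊗ W`. -/
structure IsSub (M : YDData k H V) (W : Submodule k V) : Prop where
  act_mem : ∀ (h : H), ∀ z ∈ W, M.act h z ∈ W
  coact_mem : ∀ z ∈ W, M.coact z ∈ LinearMap.range (W.subtype.lTensor H)

/-- `M` is a simple Yetter-Drinfeld module: a non-zero Yetter-Drinfeld module whose only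
Yetter-Drinfeld submodules are `0` and the whole module. -/
structure IsSimpleYD (M : YDData k H V) : Prop where
  isYetterDrinfeld : M.IsYetterDrinfeld
  nontrivial : Nontrivial V
  eq_bot_or_eq_top : ∀ W : Submodule k V, M.IsSub W → W = ⊥ ∨ W = ⊤

/-- `M` and `M'` are isomorphic: there is a linear isomorphism that preserves both the action and
the coaction. -/
def Iso {V' : Type*} [AddCommGroup V'] [Module k V'] (M : YDData k H V) (M' : YDData k H V') :
    Prop :=
  ∃ f : V ≃ₗ[k] V', (∀ (h : H) (z : V), f (M.act h z) = M'.act h (f z)) ∧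
    ∀ z : V, f.toLinearMap.lTensor H (M.coact z) = M'.coact (f z)

end YDData

end YD

/-! ### The modules `V(ti, j, λ)` and `V(i, j)` -/

namespace InfTaft

section Modules

variable {k : Type u} [Field k] (n t : ℕ) [NeZero n] (ξ : k)

/-- The elements `c_j^i(k, l)` of `H(n, t, ξ)` for `0 ≤ l ≤ k`, given by `c(0, 0) = g ^ i` and
`c(k+1, l) = c(k, l) S(x) + ξ ^ (t(j-l)) x c(k, l) S(g ^ t) + c(k, l-1) S(g ^ t)`, where the last
summand is absent for `l = 0`, and `c(k+1, k+1) = c(k, k) S(g ^ t)`. We put `c(k, l) = 0` for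
`l > k`. -/
def c (i j : ℤ) : ℕ → ℕ → Taft n t ξ
  | 0, 0 => gz n t ξ i
  | 0, _ + 1 => 0
  | m + 1, 0 =>
      c i j m 0 * HopfAlgebra.antipode k (x n t ξ) +
        ξ ^ ((t : ℤ) * j) • (x n t ξ * c i j m 0 * HopfAlgebra.antipode k (g n t ξ ^ t))
  | m + 1, l + 1 =>
      if l < m then
        c i j m (l + 1) * HopfAlgebra.antipode k (x n t ξ) +
          ξ ^ ((t : ℤ) * (j - ((l + 1 : ℕ) : ℤ))) •
            (x n t ξ * c i j m (l + 1) * HopfAlgebra.antipode k (g n t ξ ^ t)) +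
          c i j m l * HopfAlgebra.antipode k (g n t ξ ^ t)
      else if l = m then c i j m m * HopfAlgebra.antipode k (g n t ξ ^ t)
      else 0

/-- The order `N` of `ξ ^ t`. -/
def ordN : ℕ := orderOf (ξ ^ t)

/-- `φ(a)`: the integer in `{1, …, N}` that is congruent to `a` modulo `N`. -/
def phi (a : ℤ) : ℕ := ((a - 1) % (ordN t ξ : ℤ) + 1).toNat

open Classical in
/-- The index `m` of the last basis vector of `V(ti, j, lam)`. -/
def lastIndex (i j : ℤ) (lam : k) : ℕ :=
  if lam = 0 then ordN t ξ - phi t ξ (-i - j) else n - 1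

theorem lastIndex_of_ne (i j : ℤ) {lam : k} (h : lam ≠ 0) : lastIndex n t ξ i j lam = n - 1 := by
  simp [lastIndex, h]

/-- The diagonal operator `g • v_a = ξ ^ (j - a) v_a`. -/
def gOp {α : Type} (idx : α → ℕ) (j : ℤ) : Module.End k (α →₀ k) :=
  Finsupp.linearCombination k fun a => Finsupp.single a (ξ ^ (j - (idx a : ℤ)))

theorem gOp_single {α : Type} (idx : α → ℕ) (j : ℤ) (a : α) (r : k) :
    gOp ξ idx j (Finsupp.single a r) = Finsupp.single a (r * ξ ^ (j - (idx a : ℤ))) := by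
  simp [gOp]

variable {n ξ}

theorem gOp_pow (hξ : IsPrimitiveRoot ξ n) {α : Type} (idx : α → ℕ) (j : ℤ) :
    gOp ξ idx j ^ n = 1 := by
  have h : ∀ (m : ℕ) (a : α) (r : k), (gOp ξ idx j ^ m) (Finsupp.single a r) =
      Finsupp.single a (r * (ξ ^ (j - (idx a : ℤ))) ^ m) := by
    intro m
    induction m with
    | zero => simp
    | succ m ih =>
      intro a r
      rw [pow_succ, Module.End.mul_apply, gOp_single, ih, pow_succ' _ m, mul_assoc]
  refine Finsupp.lhom_ext fun a r => ?_
  have e : (ξ ^ (j - (idx a : ℤ))) ^ n = 1 := by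
    rw [← zpow_natCast, ← zpow_mul, mul_comm, zpow_mul, zpow_natCast, hξ.pow_eq_one, one_zpow]
  rw [h, e, mul_one, Module.End.one_apply]

/-- The operator `x • v_a = v_(a+1)` for `a < m`, and `x • v_m = lam v_0`. -/
def xOpFin (m : ℕ) (lam : k) : Module.End k (Fin (m + 1) →₀ k) :=
  Finsupp.linearCombination k fun a =>
    if h : (a : ℕ) < m then Finsupp.single ⟨(a : ℕ) + 1, Nat.succ_lt_succ h⟩ 1
    else Finsupp.single 0 lam

/-- The operator `x • v_a = v_(a+1)`. -/
def xOpInf : Module.End k (ℕ →₀ k) :=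
  Finsupp.linearCombination k fun a => Finsupp.single (a + 1) 1

theorem xOpFin_comm (hξ : IsPrimitiveRoot ξ n) (m : ℕ) (lam : k) (hm : lam ≠ 0 → m = n - 1)
    (j : ℤ) :
    xOpFin m lam * gOp ξ (fun a : Fin (m + 1) => (a : ℕ)) j =
      ξ • (gOp ξ (fun a : Fin (m + 1) => (a : ℕ)) j * xOpFin m lam) := by
  have hξ0 : ξ ≠ 0 := hξ.ne_zero (NeZero.ne n)
  refine Finsupp.lhom_ext fun a r => ?_
  rw [LinearMap.smul_apply, Module.End.mul_apply, Module.End.mul_apply, gOp_single]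
  simp only [xOpFin, Finsupp.linearCombination_single]
  split_ifs with h
  · simp only [map_smul, gOp_single, Finsupp.smul_single, smul_eq_mul, mul_one, one_mul]
    congr 1
    have e : j - ((a : ℕ) : ℤ) = 1 + (j - (((a : ℕ) + 1 : ℕ) : ℤ)) := by push_cast; ring
    rw [e, zpow_add₀ hξ0, zpow_one]
    ring
  · simp only [map_smul, gOp_single, Finsupp.smul_single, smul_eq_mul]
    congr 1
    by_cases hl : lam = 0
    · simp [hl]
    · have ha : (a : ℕ) = n - 1 := by have := a.2; have := hm hl; omega
      have hn : 1 ≤ n := Nat.one_le_iff_ne_zero.mpr (NeZero.ne n)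
      have e : j - ((a : ℕ) : ℤ) = 1 + j - n := by rw [ha]; push_cast [hn]; ring
      rw [e, zpow_sub₀ hξ0, zpow_add₀ hξ0, zpow_natCast, hξ.pow_eq_one, zpow_one]
      simp
      ring

theorem xOpInf_comm (hξ : IsPrimitiveRoot ξ n) (j : ℤ) :
    xOpInf * gOp ξ (fun a : ℕ => a) j = ξ • (gOp ξ (fun a : ℕ => a) j * xOpInf) := by
  have hξ0 : ξ ≠ 0 := hξ.ne_zero (NeZero.ne n)
  refine Finsupp.lhom_ext fun a r => ?_
  rw [LinearMap.smul_apply, Module.End.mul_apply, Module.End.mul_apply, gOp_single]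
  simp only [xOpInf, Finsupp.linearCombination_single, map_smul, gOp_single, Finsupp.smul_single,
    smul_eq_mul, mul_one, one_mul]
  congr 1
  have e : j - (a : ℤ) = 1 + (j - ((a + 1 : ℕ) : ℤ)) := by push_cast; ring
  rw [e, zpow_add₀ hξ0, zpow_one]
  ring

/-- The module `V(ti, j, lam)`: it has the basis `v_0, …, v_m`, where `m = N - φ(-i-j)` if
`lam = 0` and `m = n - 1` otherwise, with `g • v_a = ξ ^ (j-a) v_a`, `x • v_a = v_(a+1)` for `a < m`,
`x • v_m = lam v_0`, and `δ(v_a) = ∑_{l ≤ a} c_j^{ti}(a, l) ⊗ v_l`. -/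
def VFin (hξ : IsPrimitiveRoot ξ n) (i j : ℤ) (lam : k) :
    YDData k (Taft n t ξ) (Fin (lastIndex n t ξ i j lam + 1) →₀ k) where
  act := lift t (gOp ξ (fun a : Fin (lastIndex n t ξ i j lam + 1) => (a : ℕ)) j) (xOpFin _ lam) (gOp_pow hξ _ j)
    (xOpFin_comm hξ _ lam (fun h => lastIndex_of_ne n t ξ i j h) j)
  coact := Finsupp.linearCombination k fun a =>
    ∑ l ∈ Finset.univ.filter (fun l => l ≤ a),
      c n t ξ ((t : ℤ) * i) j (a : ℕ) (l : ℕ) ⊗ₜ[k] Finsupp.single l 1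

/-- The module `V(i, j)`: it has the basis `v_0, v_1, …`, with `g • v_a = ξ ^ (j-a) v_a`,
`x • v_a = v_(a+1)`, and `δ(v_a) = ∑_{l ≤ a} c_j^i(a, l) ⊗ v_l`. -/
def VInf (hξ : IsPrimitiveRoot ξ n) (i j : ℤ) : YDData k (Taft n t ξ) (ℕ →₀ k) where
  act := lift t (gOp ξ (fun a : ℕ => a) j) xOpInf (gOp_pow hξ _ j) (xOpInf_comm hξ j)
  coact := Finsupp.linearCombination k fun a =>
    ∑ l ∈ Finset.range (a + 1), c n t ξ i j a l ⊗ₜ[k] Finsupp.single l 1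

variable (n)

/-- The set `𝒥` of the integers that are not congruent modulo `n` to a multiple of `t`. -/
def setJ : Set ℤ := {i | ∀ m : ℤ, ¬ i ≡ (t : ℤ) * m [ZMOD (n : ℤ)]}

end Modules

end InfTaft

end

/-! Write q = ξ^t, and call z a weight vector of weight (i, j) if δ(z) = g^i ⊗ z and g z = ξ^j z.
Everything is controlled by such vectors and by a closed form for the structure constants.

The monomials x^b g^a form a basis of H (`pbw`), and in it c_j^i(m, l) is a scalar times x^(m-l)
g^(i-tm) (`c_eq`). With m = l + d the scalar is q^(d choose 2) times a Gaussian binomial times the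
product of ξ^(t(j-l-s)) - ξ^(-i) over s < d (`alpha_add`). The last factor does not depend on l once
m is fixed, so whenever it vanishes all c(m, l) with l < m vanish together, and x^m z is again a
weight vector.

Every non-zero Yetter–Drinfeld module contains a weight vector (`exists_isWeight`): the top x-degree
part of a coaction is grouplike by coassociativity, and g has order dividing n with all n-th roots
of unity in k. The x^m z span a Yetter–Drinfeld submodule, so a simple module is generated under x
by any of its non-zero weight vectors.

If i is in 𝒥, no factor of the product vanishes. A suitable functional on H then recovers z from any
non-zero vector; hence V(i, j) is simple, and the map V(i, j) → M sending v_0 to z is an isomorphism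
by Schur's lemma (`VInf_iso`).

If i is replaced by ti, then x^p z is a weight vector when p ≡ i + j + 1 mod N, and also when N
divides p. For the least such positive p of the first kind, either x^p z = 0 and M ≅ V(ti, j, 0), or
x^p z generates M, which forces M to be finite-dimensional (`iso_or_cyclic_eq_top`,
`finiteDimensional_of_mem_cyclic`). In finite dimension x^n has an eigenvector y, with eigenvalue λ,
on the weight space; for λ ≠ 0 this gives V(ti, j, λ), and for λ = 0 the second alternative for y
would make x both surjective and nilpotent.

For the isomorphisms, x^n acts on V(ti, j, λ) as λ. For V(ti, j, 0) and for V(i, j) with i in 𝒥 the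
only grouplike vectors are multiples of v_0, so the weight is an invariant. For λ ≠ 0 a weight
vector is a multiple of some v_a, and c(a, a-1) = 0 forces a ≡ 0 or a ≡ i + j + 1 mod N. -/

set_option linter.unusedSectionVars false

noncomputable section

namespace InfTaft

/-! ### The basis x^b g^a of H -/

section PBW

variable {k : Type u} [Field k] {n : ℕ} [NeZero n] {ξ : k}

theorem gz_mul_n (t : ℕ) (e : ℤ) : gz n t ξ (n * e) = 1 := by
  have h : gUnit n t ξ ^ n = 1 := by ext; simp [gUnit]
  rw [gz, zpow_mul, zpow_natCast, h, one_zpow, Units.val_one]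

theorem gz_congr (t : ℕ) {a b : ℤ} (h : a ≡ b [ZMOD (n : ℤ)]) : gz n t ξ a = gz n t ξ b := by
  obtain ⟨e, he⟩ := h.dvd
  rw [show b = a + n * e by linarith, gz_add, gz_mul_n, mul_one]

theorem gz_eq_pow_val (t : ℕ) (a : ℤ) : gz n t ξ a = g n t ξ ^ (a : ZMod n).val := by
  rw [← gz_natCast]
  apply gz_congr
  rw [← ZMod.intCast_eq_intCast_iff]
  simp

theorem gz_mul_x (hξ : ξ ≠ 0) (t : ℕ) (e : ℤ) :
    gz n t ξ e * x n t ξ = ξ ^ (-e) • (x n t ξ * gz n t ξ e) := by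
  induction e with
  | zero => simp [gz_zero]
  | succ m ih =>
    have h : g n t ξ * x n t ξ = ξ⁻¹ • (x n t ξ * g n t ξ) := by
      rw [x_mul_g, smul_smul, inv_mul_cancel₀ hξ, one_smul]
    rw [gz_add, gz_one, mul_assoc, h, mul_smul_comm, ← mul_assoc, ih, smul_mul_assoc, smul_smul,
      mul_assoc]
    congr 1
    rw [neg_add, zpow_add₀ hξ, zpow_neg_one, mul_comm]
  | pred m ih =>
    rw [sub_eq_add_neg, gz_add, mul_assoc, gz_neg_one_mul_x, mul_smul_comm, ← mul_assoc, ih,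
      smul_mul_assoc, smul_smul, mul_assoc]
    congr 1
    rw [neg_add, neg_neg 1, zpow_add₀ hξ, zpow_one, mul_comm]

theorem gz_mul_x_pow (hξ : ξ ≠ 0) (t : ℕ) (e : ℤ) (b : ℕ) :
    gz n t ξ e * x n t ξ ^ b = ξ ^ (-e * b) • (x n t ξ ^ b * gz n t ξ e) := by
  induction b with
  | zero => simp
  | succ b ih =>
    rw [pow_succ, ← mul_assoc, ih, smul_mul_assoc, mul_assoc, gz_mul_x hξ, mul_smul_comm,
      smul_smul, ← mul_assoc]
    congr 1
    rw [← zpow_add₀ hξ]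
    congr 1
    push_cast
    ring

/-- Left multiplication by `x` in the basis `x ^ b g ^ a`. -/
def regX (k : Type u) [Field k] (n : ℕ) : Module.End k (ℕ × ZMod n →₀ k) :=
  Finsupp.linearCombination k fun p => Finsupp.single (p.1 + 1, p.2) 1

/-- Left multiplication by `g` in the basis `x ^ b g ^ a`. -/
def regG (n : ℕ) (ξ : k) : Module.End k (ℕ × ZMod n →₀ k) :=
  Finsupp.linearCombination k fun p => Finsupp.single (p.1, p.2 + 1) (ξ ^ (-(p.1 : ℤ)))

theorem regX_single (p : ℕ × ZMod n) (r : k) :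
    regX k n (Finsupp.single p r) = Finsupp.single (p.1 + 1, p.2) r := by
  simp [regX]

theorem regG_single (p : ℕ × ZMod n) (r : k) :
    regG n ξ (Finsupp.single p r) = Finsupp.single (p.1, p.2 + 1) (r * ξ ^ (-(p.1 : ℤ))) := by
  simp [regG]

theorem regG_pow_single (m : ℕ) (p : ℕ × ZMod n) (r : k) :
    (regG n ξ ^ m) (Finsupp.single p r) =
      Finsupp.single (p.1, p.2 + m) (r * (ξ ^ (-(p.1 : ℤ))) ^ m) := by
  induction m generalizing r p with
  | zero => simp
  | succ m ih =>
    rw [pow_succ, Module.End.mul_apply, regG_single, ih]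
    dsimp only
    rw [pow_succ' _ m, mul_assoc, Nat.cast_succ, add_assoc, add_comm 1 (m : ZMod n)]

theorem zpow_pow_eq_one (hξ : IsPrimitiveRoot ξ n) (e : ℤ) : (ξ ^ e) ^ n = 1 := by
  rw [← zpow_natCast, ← zpow_mul, mul_comm, zpow_mul, zpow_natCast, hξ.pow_eq_one, one_zpow]

theorem regG_pow (hξ : IsPrimitiveRoot ξ n) : regG n ξ ^ n = 1 := by
  refine Finsupp.lhom_ext fun p r => ?_
  rw [regG_pow_single, zpow_pow_eq_one hξ]
  simp

theorem regX_mul_regG (hξ : ξ ≠ 0) : regX k n * regG n ξ = ξ • (regG n ξ * regX k n) := by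
  refine Finsupp.lhom_ext fun p r => ?_
  simp only [LinearMap.smul_apply, Module.End.mul_apply, regX_single, regG_single,
    Finsupp.smul_single, smul_eq_mul]
  congr 1
  rw [show (-(p.1 : ℤ)) = 1 + -((p.1 + 1 : ℕ) : ℤ) by push_cast; ring, zpow_add₀ hξ, zpow_one]
  ring

/-- The regular representation in coordinates. -/
def regRep (hξ : IsPrimitiveRoot ξ n) (t : ℕ) :
    Taft n t ξ →ₐ[k] Module.End k (ℕ × ZMod n →₀ k) :=
  lift t (regG n ξ) (regX k n) (regG_pow hξ) (regX_mul_regG (hξ.ne_zero (NeZero.ne n)))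

/-- The coordinates of an element in the basis `x ^ b g ^ a`. -/
def toCoord (hξ : IsPrimitiveRoot ξ n) (t : ℕ) : Taft n t ξ →ₗ[k] (ℕ × ZMod n →₀ k) :=
  (LinearMap.applyₗ (Finsupp.single (0, 0) 1)) ∘ₗ (regRep hξ t).toLinearMap

/-- The element with given coordinates. -/
def ofCoord (n t : ℕ) (ξ : k) : (ℕ × ZMod n →₀ k) →ₗ[k] Taft n t ξ :=
  Finsupp.linearCombination k fun p => x n t ξ ^ p.1 * g n t ξ ^ p.2.val

theorem ofCoord_single (t : ℕ) (p : ℕ × ZMod n) (r : k) :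
    ofCoord n t ξ (Finsupp.single p r) = r • (x n t ξ ^ p.1 * g n t ξ ^ p.2.val) := by
  simp [ofCoord]

theorem toCoord_x_pow_mul_g_pow (hξ : IsPrimitiveRoot ξ n) (t b a : ℕ) :
    toCoord hξ t (x n t ξ ^ b * g n t ξ ^ a) = Finsupp.single (b, (a : ZMod n)) 1 := by
  have h : ∀ b : ℕ, (regX k n ^ b) (Finsupp.single (0, (a : ZMod n)) 1) =
      Finsupp.single (b, (a : ZMod n)) 1 := by
    intro b
    induction b with
    | zero => simp
    | succ b ih => rw [pow_succ', Module.End.mul_apply, ih, regX_single]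
  simp [toCoord, regRep, regG_pow_single, h]

/-- Applied to the coordinates of 1, this makes `ofCoord` a left inverse of `toCoord`, so the
monomials span; their independence is `toCoord_x_pow_mul_g_pow`. -/
theorem ofCoord_regRep (hξ : IsPrimitiveRoot ξ n) (t : ℕ) (h : Taft n t ξ)
    (f : ℕ × ZMod n →₀ k) : ofCoord n t ξ (regRep hξ t h f) = h * ofCoord n t ξ f := by
  induction h using induction_taft generalizing f with
  | hc c => simp [Algebra.smul_def]
  | hg =>
    induction f using Finsupp.induction_linear with
    | zero => simp
    | add p q hp hq => simp only [map_add, hp, hq, mul_add]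
    | single p r =>
      simp only [regRep, lift_g, regG_single, ofCoord_single]
      have h1 : g n t ξ ^ (p.2 + 1).val = gz n t ξ 1 * gz n t ξ (p.2.val) := by
        rw [← gz_add, gz_eq_pow_val]
        simp [add_comm]
      rw [h1, mul_smul_comm, ← mul_assoc (g n t ξ), ← gz_one, gz_mul_x_pow
        (hξ.ne_zero (NeZero.ne n)), smul_mul_assoc, smul_smul, mul_assoc, gz_natCast]
      simp [gz_one]
  | hx =>
    induction f using Finsupp.induction_linear with
    | zero => simp
    | add p q hp hq => simp only [map_add, hp, hq, mul_add]
    | single p r => simp [regRep, regX_single, ofCoord_single, pow_succ', mul_assoc]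
  | ha a b h1 h2 => simp [h1, h2, add_mul]
  | hm a b h1 h2 => simp [h1, h2, mul_assoc]

/-- The basis `x ^ b g ^ a` of `H(n, t, ξ)`. -/
def pbw (hξ : IsPrimitiveRoot ξ n) (t : ℕ) : Module.Basis (ℕ × ZMod n) k (Taft n t ξ) :=
  Module.Basis.ofRepr <| LinearEquiv.ofLinearMap (toCoord hξ t) (ofCoord n t ξ)
    (by
      refine Finsupp.lhom_ext fun p r => ?_
      simp [ofCoord_single, toCoord_x_pow_mul_g_pow])
    (by
      refine LinearMap.ext fun h => ?_
      simp [toCoord, ofCoord_regRep, ofCoord_single])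

theorem pbw_apply (hξ : IsPrimitiveRoot ξ n) (t : ℕ) (p : ℕ × ZMod n) :
    pbw hξ t p = x n t ξ ^ p.1 * g n t ξ ^ p.2.val := by
  simp [pbw, ofCoord_single]

/-- The coefficient of `x ^ b g ^ a`. -/
def coeff (hξ : IsPrimitiveRoot ξ n) (t : ℕ) (b : ℕ) (a : ℤ) : Taft n t ξ →ₗ[k] k :=
  (pbw hξ t).coord (b, (a : ZMod n))

theorem coeff_x_pow_mul_gz (hξ : IsPrimitiveRoot ξ n) (t b b' : ℕ) (a a' : ℤ) :
    coeff hξ t b a (x n t ξ ^ b' * gz n t ξ a') =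
      if b' = b ∧ a' ≡ a [ZMOD (n : ℤ)] then 1 else 0 := by
  have h : x n t ξ ^ b' * gz n t ξ a' = pbw hξ t (b', (a' : ZMod n)) := by
    rw [pbw_apply, gz_eq_pow_val]
  rw [h, coeff, Module.Basis.coord_apply, Module.Basis.repr_self, Finsupp.single_apply]
  simp only [Prod.mk.injEq, ZMod.intCast_eq_intCast_iff]

theorem coeff_gz (hξ : IsPrimitiveRoot ξ n) (t b : ℕ) (a a' : ℤ) :
    coeff hξ t b a (gz n t ξ a') = if 0 = b ∧ a' ≡ a [ZMOD (n : ℤ)] then 1 else 0 := by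
  simpa using coeff_x_pow_mul_gz hξ t b 0 a a'

theorem coeff_zero_x_mul (hξ : IsPrimitiveRoot ξ n) (t : ℕ) (a : ℤ) (h : Taft n t ξ) :
    coeff hξ t 0 a (x n t ξ * h) = 0 := by
  have H : coeff hξ t 0 a ∘ₗ LinearMap.mulLeft k (x n t ξ) = 0 := by
    refine (pbw hξ t).ext fun p => ?_
    rw [LinearMap.comp_apply, LinearMap.mulLeft_apply, pbw_apply, ← mul_assoc, ← pow_succ',
      ← gz_natCast, coeff_x_pow_mul_gz]
    simp
  exact LinearMap.congr_fun H h

theorem coeff_succ_x_mul (hξ : IsPrimitiveRoot ξ n) (t b : ℕ) (a : ℤ) (h : Taft n t ξ) :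
    coeff hξ t (b + 1) a (x n t ξ * h) = coeff hξ t b a h := by
  have H : coeff hξ t (b + 1) a ∘ₗ LinearMap.mulLeft k (x n t ξ) = coeff hξ t b a := by
    refine (pbw hξ t).ext fun p => ?_
    rw [LinearMap.comp_apply, LinearMap.mulLeft_apply, pbw_apply, ← mul_assoc, ← pow_succ',
      ← gz_natCast, coeff_x_pow_mul_gz, coeff_x_pow_mul_gz]
    simp
  exact LinearMap.congr_fun H h

end PBW

/-! ### Gaussian binomials and the closed form of c_j^i(m, l) -/

section StructureConstants

variable {k : Type u} [Field k]

/-- The Gaussian binomial coefficient `(l + d choose l)` at the parameter `q`. -/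
def gauss (q : k) : ℕ → ℕ → k
  | 0, _ => 1
  | _ + 1, 0 => 1
  | l + 1, d + 1 => gauss q (l + 1) d + q ^ (d + 1) * gauss q l (d + 1)

theorem gauss_zero_right (q : k) (l : ℕ) : gauss q l 0 = 1 := by
  cases l <;> rw [gauss]

theorem gauss_rec (q : k) (l d : ℕ) :
    gauss q (l + 1) (d + 1) = gauss q (l + 1) d + q ^ (d + 1) * gauss q l (d + 1) := by
  rw [gauss]

/-- A division-free substitute for the quotient formula by q-factorials, which is meaningless at a
root of unity. It turns one Pascal rule into the other. -/
theorem gauss_ratio (q : k) (l d : ℕ) :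
    (q ^ (l + 1) - 1) * gauss q (l + 1) d = (q ^ (d + 1) - 1) * gauss q l (d + 1) := by
  induction l generalizing d with
  | zero =>
    induction d with
    | zero => simp [gauss]
    | succ d ih =>
      rw [gauss_rec, mul_add, ih]
      simp only [gauss]
      ring
  | succ l ihl =>
    induction d with
    | zero =>
      have h := ihl 0
      rw [gauss_zero_right] at h ⊢
      rw [gauss_rec, gauss_zero_right]
      linear_combination q * h
    | succ d ih =>
      rw [gauss_rec q (l + 1) d, gauss_rec q l (d + 1), mul_add, ih]
      linear_combination q ^ (d + 1 + 1) * ihl (d + 1)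

theorem gauss_succ_succ (q : k) (l d : ℕ) :
    gauss q (l + 1) (d + 1) = q ^ (l + 1) * gauss q (l + 1) d + gauss q l (d + 1) := by
  have h := gauss_ratio q l d
  rw [gauss]
  linear_combination -h

/-- The scalars in `c_j^i(m, l) = alpha(m, l) x ^ (m - l) g ^ (i - t m)`. -/
def alpha (t : ℕ) (ξ : k) (i j : ℤ) : ℕ → ℕ → k
  | 0, 0 => 1
  | 0, _ + 1 => 0
  | m + 1, 0 => (ξ ^ ((t : ℤ) * j) - ξ ^ ((t : ℤ) * m - i)) * alpha t ξ i j m 0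
  | m + 1, l + 1 =>
      (ξ ^ ((t : ℤ) * (j - ((l + 1 : ℕ) : ℤ))) - ξ ^ ((t : ℤ) * m - i)) *
        alpha t ξ i j m (l + 1) + alpha t ξ i j m l

theorem alpha_of_lt (t : ℕ) (ξ : k) (i j : ℤ) {m l : ℕ} (h : m < l) : alpha t ξ i j m l = 0 := by
  induction m generalizing l with
  | zero =>
    obtain ⟨l, rfl⟩ := Nat.exists_eq_succ_of_ne_zero h.ne'
    rw [alpha]
  | succ m ih =>
    obtain ⟨l, rfl⟩ := Nat.exists_eq_succ_of_ne_zero (Nat.ne_zero_of_lt h)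
    rw [alpha, ih (by omega), ih (by omega), mul_zero, zero_add]

theorem alpha_self (t : ℕ) (ξ : k) (i j : ℤ) (m : ℕ) : alpha t ξ i j m m = 1 := by
  induction m with
  | zero => rw [alpha]
  | succ m ih => rw [alpha, ih, alpha_of_lt _ _ _ _ (Nat.lt_succ_self m), mul_zero, zero_add]

/-- Induction on l and then on d. After the common factors are pulled out, the recursion is linear
in ξ^(t(j-l-1-d)) and ξ^(-i): the coefficient of the first is one Pascal rule, that of the second is
the other. -/
theorem alpha_add (t : ℕ) {ξ : k} (hξ : ξ ≠ 0) (i j : ℤ) (l d : ℕ) :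
    alpha t ξ i j (l + d) l = (ξ ^ t) ^ (d.choose 2) * gauss (ξ ^ t) l d *
      ∏ s ∈ Finset.range d, (ξ ^ ((t : ℤ) * (j - (l + s : ℕ))) - ξ ^ (-i)) := by
  have hpow : ∀ m : ℕ, (ξ ^ t) ^ m = ξ ^ ((t : ℤ) * m) := fun m => by
    rw [← pow_mul, ← zpow_natCast]; push_cast; rfl
  have hch : ∀ d : ℕ, (d + 1).choose 2 = d.choose 2 + d := fun d => by
    rw [Nat.choose_succ_succ' d 1, Nat.choose_one_right, add_comm]
  induction l generalizing d with
  | zero =>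
    induction d with
    | zero => simp [alpha, gauss]
    | succ d ih =>
      rw [← add_assoc, alpha, ih, Finset.prod_range_succ, hch, pow_add]
      have h1 : ξ ^ ((t : ℤ) * j) = (ξ ^ t) ^ d * ξ ^ ((t : ℤ) * (j - (0 + d : ℕ))) := by
        rw [hpow, ← zpow_add₀ hξ]; congr 1; push_cast; ring
      have h2 : ξ ^ ((t : ℤ) * (0 + d : ℕ) - i) = (ξ ^ t) ^ d * ξ ^ (-i) := by
        rw [hpow, ← zpow_add₀ hξ]; congr 1; push_cast; ring
      rw [h1, h2]
      simp only [gauss]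
      ring
  | succ l ihl =>
    induction d with
    | zero => simp [alpha_self, gauss]
    | succ d ih =>
      have e : l + 1 + (d + 1) = (l + 1 + d) + 1 := by ring
      rw [e, alpha, ih, show l + 1 + d = l + (d + 1) by ring, ihl, Finset.prod_range_succ' _ d,
        Finset.prod_range_succ _ d, hch, pow_add]
      have h0 : ∏ s ∈ Finset.range d, (ξ ^ ((t : ℤ) * (j - (l + (s + 1) : ℕ))) - ξ ^ (-i)) =
          ∏ s ∈ Finset.range d, (ξ ^ ((t : ℤ) * (j - (l + 1 + s : ℕ))) - ξ ^ (-i)) := by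
        refine Finset.prod_congr rfl fun s _ => ?_
        rw [show l + (s + 1) = l + 1 + s by ring]
      rw [h0]
      set P := ∏ s ∈ Finset.range d, (ξ ^ ((t : ℤ) * (j - (l + 1 + s : ℕ))) - ξ ^ (-i))
      have h1 : ξ ^ ((t : ℤ) * (j - (l + 1 : ℕ))) =
          (ξ ^ t) ^ d * ξ ^ ((t : ℤ) * (j - (l + 1 + d : ℕ))) := by
        rw [hpow, ← zpow_add₀ hξ]; congr 1; push_cast; ring
      have h2 : ξ ^ ((t : ℤ) * (l + (d + 1) : ℕ) - i) =
          (ξ ^ t) ^ d * (ξ ^ t) ^ (l + 1) * ξ ^ (-i) := by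
        rw [hpow, hpow, ← zpow_add₀ hξ, ← zpow_add₀ hξ]; congr 1; push_cast; ring
      have h3 : ξ ^ ((t : ℤ) * (j - (l + 0 : ℕ))) =
          (ξ ^ t) ^ (d + 1) * ξ ^ ((t : ℤ) * (j - (l + 1 + d : ℕ))) := by
        rw [hpow, ← zpow_add₀ hξ]; congr 1; push_cast; ring
      rw [h1, h2, h3]
      have g1 := gauss_rec (ξ ^ t) l d
      have g2 := gauss_succ_succ (ξ ^ t) l d
      generalize ξ ^ ((t : ℤ) * (j - (l + 1 + d : ℕ))) = Z at *
      generalize ξ ^ (-i) = y at *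
      linear_combination (-(ξ ^ t) ^ (d.choose 2) * (ξ ^ t) ^ d * P * Z) * g1 +
        ((ξ ^ t) ^ (d.choose 2) * (ξ ^ t) ^ d * P * y) * g2

/-- For l = 0 the Gaussian binomial is 1, so only the factors of the product can vanish. -/
theorem alpha_zero_right_ne_zero (t : ℕ) {ξ : k} (hξ : ξ ≠ 0) (i j : ℤ) (m : ℕ)
    (h : ∀ s < m, ξ ^ ((t : ℤ) * (j - s)) ≠ ξ ^ (-i)) : alpha t ξ i j m 0 ≠ 0 := by
  have e := alpha_add t hξ i j 0 m
  rw [zero_add] at e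
  rw [e, gauss, mul_one]
  refine mul_ne_zero (pow_ne_zero _ (pow_ne_zero _ hξ)) (Finset.prod_ne_zero_iff.mpr ?_)
  intro s hs
  rw [zero_add]
  exact sub_ne_zero.mpr (h s (Finset.mem_range.mp hs))

/-- The offending factor is the last one of the product, and it is the same for all l ≤ p. -/
theorem alpha_eq_zero (t : ℕ) {ξ : k} (hξ : ξ ≠ 0) (i j : ℤ) {p l : ℕ} (hl : l ≤ p)
    (h : ξ ^ ((t : ℤ) * (j - p)) = ξ ^ (-i)) : alpha t ξ i j (p + 1) l = 0 := by
  obtain ⟨d, rfl⟩ := Nat.exists_eq_add_of_le hl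
  rw [add_assoc, alpha_add t hξ, Finset.prod_range_succ, h, sub_self, mul_zero, mul_zero]

/-- For d = 1 the scalar is (1 + q + … + q^p) times a single factor, and (q - 1) times the geometric
sum is q^(p+1) - 1. -/
theorem eq_of_alpha_succ_self_eq_zero (t : ℕ) {ξ : k} (hξ : ξ ≠ 0) (i j : ℤ) {p : ℕ}
    (h : alpha t ξ i j (p + 1) p = 0) :
    (ξ ^ t) ^ (p + 1) = 1 ∨ ξ ^ ((t : ℤ) * (j - p)) = ξ ^ (-i) := by
  have e := alpha_add t hξ i j p 1
  have r := gauss_ratio (ξ ^ t) p 0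
  rw [h] at e
  rw [gauss_zero_right] at r
  simp only [Finset.prod_range_one, add_zero, Nat.choose_eq_zero_of_lt one_lt_two, pow_zero,
    one_mul, zero_add, pow_one, mul_one] at e r
  rcases mul_eq_zero.mp e.symm with h1 | h1
  · left; rw [h1, mul_zero] at r; exact sub_eq_zero.mp r
  · right; exact sub_eq_zero.mp h1

variable {n : ℕ} [NeZero n] {ξ : k}

theorem antipode_x (t : ℕ) :
    HopfAlgebra.antipode k (x n t ξ) = -(x n t ξ * gz n t ξ (-(t : ℤ))) :=
  antipodeLin_x n t ξ

theorem antipode_g (t : ℕ) : HopfAlgebra.antipode k (g n t ξ) = gz n t ξ (-1) :=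
  antipodeLin_g n t ξ

theorem antipode_g_pow (t m : ℕ) :
    HopfAlgebra.antipode k (g n t ξ ^ m) = gz n t ξ (-(m : ℤ)) :=
  antipodeLin_g_pow n t ξ m

theorem antipode_mul (t : ℕ) (a b : Taft n t ξ) : HopfAlgebra.antipode k (a * b) =
    HopfAlgebra.antipode k b * HopfAlgebra.antipode k a :=
  antipodeLin_mul n t ξ a b

theorem c_of_lt (t : ℕ) (i j : ℤ) {m l : ℕ} (h : m < l) : c n t ξ i j m l = 0 := by
  obtain ⟨l, rfl⟩ := Nat.exists_eq_succ_of_ne_zero (Nat.ne_zero_of_lt h)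
  cases m with
  | zero => rw [c]
  | succ m => rw [c, if_neg (by omega), if_neg (by omega)]

theorem c_succ_zero (t : ℕ) (i j : ℤ) (m : ℕ) : c n t ξ i j (m + 1) 0 =
    c n t ξ i j m 0 * HopfAlgebra.antipode k (x n t ξ) +
      ξ ^ ((t : ℤ) * j) • (x n t ξ * c n t ξ i j m 0 * HopfAlgebra.antipode k (g n t ξ ^ t)) := by
  rw [c]

theorem c_succ_succ (t : ℕ) (i j : ℤ) (m l : ℕ) : c n t ξ i j (m + 1) (l + 1) =
    c n t ξ i j m (l + 1) * HopfAlgebra.antipode k (x n t ξ) +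
      ξ ^ ((t : ℤ) * (j - ((l + 1 : ℕ) : ℤ))) •
        (x n t ξ * c n t ξ i j m (l + 1) * HopfAlgebra.antipode k (g n t ξ ^ t)) +
      c n t ξ i j m l * HopfAlgebra.antipode k (g n t ξ ^ t) := by
  rw [c]
  split_ifs with h1 h2
  · rfl
  · subst h2
    rw [c_of_lt t i j (Nat.lt_succ_self l)]
    simp
  · rw [c_of_lt t i j (show m < l + 1 by omega), c_of_lt t i j (show m < l by omega)]
    simp

/-- Moving g^e past the x in S(x) produces the factor ξ^(-e); this is the origin of the differences
in `alpha`. -/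
theorem x_pow_mul_gz_step (hξ : ξ ≠ 0) (t b : ℕ) (e e' : ℤ) (r : k) (he : e' = e - t) :
    x n t ξ ^ b * gz n t ξ e * HopfAlgebra.antipode k (x n t ξ) +
      r • (x n t ξ * (x n t ξ ^ b * gz n t ξ e) * HopfAlgebra.antipode k (g n t ξ ^ t)) =
    (r - ξ ^ (-e)) • (x n t ξ ^ (b + 1) * gz n t ξ e') := by
  have h : x n t ξ ^ b * gz n t ξ e * (x n t ξ * gz n t ξ (-(t : ℤ))) =
      ξ ^ (-e) • (x n t ξ ^ (b + 1) * gz n t ξ e') := by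
    rw [mul_assoc, ← mul_assoc (gz n t ξ e), gz_mul_x hξ, smul_mul_assoc, mul_smul_comm, mul_assoc,
      ← gz_add, ← mul_assoc, ← pow_succ, he, sub_eq_add_neg]
  rw [antipode_x, antipode_g_pow, mul_neg, h, ← mul_assoc, mul_assoc, ← gz_add, ← pow_succ', he,
    sub_smul, ← sub_eq_add_neg]
  abel

theorem c_eq (hξ : ξ ≠ 0) (t : ℕ) (i j : ℤ) (m l : ℕ) :
    c n t ξ i j m l =
      alpha t ξ i j m l • (x n t ξ ^ (m - l) * gz n t ξ (i - (t : ℤ) * m)) := by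
  induction m generalizing l with
  | zero =>
    cases l with
    | zero => rw [c, alpha]; simp
    | succ l => rw [c, alpha, zero_smul]
  | succ m ih =>
    have he : i - (t : ℤ) * (m + 1 : ℕ) = i - (t : ℤ) * m - t := by push_cast; ring
    cases l with
    | zero =>
      have h := x_pow_mul_gz_step (n := n) hξ t m (i - (t : ℤ) * m) _ (ξ ^ ((t : ℤ) * j)) he
      rw [c_succ_zero, ih, smul_mul_assoc, mul_smul_comm, smul_mul_assoc, smul_comm, ← smul_add,
        Nat.sub_zero, h, alpha, smul_smul, mul_comm, Nat.sub_zero, neg_sub]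
    | succ l =>
      rcases lt_or_ge m (l + 1) with hl | hl
      · rcases Nat.lt_or_ge m l with hl' | hl'
        · rw [c_of_lt t i j (by omega), alpha_of_lt t ξ i j (by omega), zero_smul]
        · obtain rfl : m = l := by omega
          rw [c_succ_succ, c_of_lt t i j hl, ih, alpha_self, alpha_self, he,
            sub_eq_add_neg _ (t : ℤ), gz_add, antipode_g_pow]
          simp
      · have h := x_pow_mul_gz_step (n := n) hξ t (m - (l + 1)) (i - (t : ℤ) * m) _
          (ξ ^ ((t : ℤ) * (j - ((l + 1 : ℕ) : ℤ)))) he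
        rw [c_succ_succ, ih, ih, smul_mul_assoc, mul_smul_comm, smul_mul_assoc, smul_comm,
          ← smul_add, h, alpha, smul_smul, mul_comm, neg_sub,
          show m - (l + 1) + 1 = m + 1 - (l + 1) by omega, show m - l = m + 1 - (l + 1) by omega,
          smul_mul_assoc, mul_assoc, antipode_g_pow, ← gz_add, ← sub_eq_add_neg, ← he, ← add_smul]

theorem c_zero_zero (t : ℕ) (i j : ℤ) : c n t ξ i j 0 0 = gz n t ξ i := by rw [c]

/-- By x-degree, only c(K, 0) among the c(m, l) with m ≤ K contains x^K. This functional therefore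
detects the leading term of a combination of the x^m z. -/
theorem coeff_c (hξ : IsPrimitiveRoot ξ n) (t : ℕ) (i j : ℤ) {K m l : ℕ} (hm : m ≤ K) :
    coeff hξ t K (i - (t : ℤ) * K) (c n t ξ i j m l) =
      if m = K ∧ l = 0 then alpha t ξ i j K 0 else 0 := by
  rw [c_eq (hξ.ne_zero (NeZero.ne n)), map_smul, coeff_x_pow_mul_gz]
  by_cases h : m = K ∧ l = 0
  · obtain ⟨rfl, rfl⟩ := h
    simp [Int.ModEq.refl]
  · rw [if_neg h]
    rcases Nat.lt_or_ge m l with hl | hl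
    · rw [alpha_of_lt _ _ _ _ hl, zero_smul]
    · rw [if_neg (by omega), smul_zero]

theorem gz_mul_c (hξ : ξ ≠ 0) (t : ℕ) (i j e : ℤ) (m l : ℕ) :
    gz n t ξ e * c n t ξ i j m l * gz n t ξ (-e) =
      ξ ^ (-e * (m - l : ℤ)) • c n t ξ i j m l := by
  rcases Nat.lt_or_ge m l with hl | hl
  · simp [c_of_lt t i j hl]
  · rw [c_eq hξ, mul_smul_comm, ← mul_assoc, gz_mul_x_pow hξ, smul_mul_assoc, smul_mul_assoc,
      smul_mul_assoc, mul_assoc, mul_assoc, ← gz_add, ← gz_add, smul_comm, Nat.cast_sub hl,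
      add_neg_cancel_comm_assoc]

theorem alpha_eq_zero_of_c_eq_zero (hξ : IsPrimitiveRoot ξ n) (t : ℕ) (i j : ℤ) {m l : ℕ}
    (h : c n t ξ i j m l = 0) : alpha t ξ i j m l = 0 := by
  have h1 := congrArg (coeff hξ t (m - l) (i - (t : ℤ) * m)) h
  rw [c_eq (hξ.ne_zero (NeZero.ne n)), map_smul, coeff_x_pow_mul_gz, if_pos ⟨rfl, rfl⟩,
    map_zero] at h1
  simpa using h1

end StructureConstants

end InfTaft

namespace YDData

/-! ### Subobjects, homomorphisms and Schur's lemma -/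

section General

variable {k : Type u} [Field k] {H : Type v} [Ring H] [HopfAlgebra k H]
variable {V : Type*} [AddCommGroup V] [Module k V] {V' : Type*} [AddCommGroup V'] [Module k V']

/-- Contraction of the first tensor factor with a linear functional. -/
def contr (φ : H →ₗ[k] k) (V : Type*) [AddCommGroup V] [Module k V] : H ⊗[k] V →ₗ[k] V :=
  (TensorProduct.lid k V).toLinearMap ∘ₗ φ.rTensor V

@[simp]
theorem contr_tmul (φ : H →ₗ[k] k) (h : H) (z : V) : contr φ V (h ⊗ₜ[k] z) = φ h • z := by
  simp [contr]

theorem contr_lTensor (φ : H →ₗ[k] k) (f : V →ₗ[k] V') (u : H ⊗[k] V) :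
    contr φ V' (f.lTensor H u) = f (contr φ V u) := by
  induction u using TensorProduct.induction_on with
  | zero => simp
  | tmul a b => simp
  | add p q hp hq => simp only [map_add, hp, hq]

theorem contr_assoc (φ : H →ₗ[k] k) (u : H ⊗[k] H) (z : V) :
    contr φ (H ⊗[k] V) (TensorProduct.assoc k H H V (u ⊗ₜ[k] z)) = contr φ H u ⊗ₜ[k] z := by
  induction u using TensorProduct.induction_on with
  | zero => simp
  | tmul a b => simp [TensorProduct.smul_tmul']
  | add p q hp hq => simp only [map_add, TensorProduct.add_tmul, hp, hq]

theorem IsSub.contr_mem {M : YDData k H V} {W : Submodule k V} (hW : M.IsSub W) (φ : H →ₗ[k] k)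
    {z : V} (hz : z ∈ W) : contr φ V (M.coact z) ∈ W := by
  obtain ⟨u, hu⟩ := hW.coact_mem z hz
  rw [← hu, contr_lTensor]
  exact (contr φ W u).2

/-- A linear map that preserves the action and the coaction. -/
structure IsHom (M : YDData k H V) (M' : YDData k H V') (f : V →ₗ[k] V') : Prop where
  act : ∀ (h : H) (z : V), f (M.act h z) = M'.act h (f z)
  coact : ∀ z : V, f.lTensor H (M.coact z) = M'.coact (f z)

/-- H is flat over the field k, so the kernel of id ⊗ f is the image of H ⊗ ker f. -/
theorem IsHom.isSub_ker {M : YDData k H V} {M' : YDData k H V'} {f : V →ₗ[k] V'}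
    (hf : IsHom M M' f) : M.IsSub (LinearMap.ker f) where
  act_mem h z hz := by rw [LinearMap.mem_ker] at hz ⊢; rw [hf.act, hz, map_zero]
  coact_mem z hz := by
    have hex : Function.Exact (LinearMap.ker f).subtype f := LinearMap.exact_subtype_ker_map f
    have h := Module.Flat.lTensor_exact H hex
    refine (h (M.coact z)).mp ?_
    rw [hf.coact, LinearMap.mem_ker.mp hz, map_zero]

theorem IsHom.isSub_range {M : YDData k H V} {M' : YDData k H V'} {f : V →ₗ[k] V'}
    (hf : IsHom M M' f) : M'.IsSub (LinearMap.range f) where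
  act_mem h z hz := by
    obtain ⟨y, rfl⟩ := hz
    exact ⟨M.act h y, hf.act h y⟩
  coact_mem z hz := by
    obtain ⟨y, rfl⟩ := hz
    refine ⟨f.rangeRestrict.lTensor H (M.coact y), ?_⟩
    rw [← hf.coact, ← LinearMap.comp_apply, ← LinearMap.lTensor_comp]
    rfl

theorem IsHom.iso {M : YDData k H V} {M' : YDData k H V'} {f : V →ₗ[k] V'} (hf : IsHom M M' f)
    (hM : M.IsSimpleYD) (hM' : M'.IsSimpleYD) {z : V} (hz : f z ≠ 0) : M'.Iso M := by
  have hker : LinearMap.ker f = ⊥ := by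
    refine (hM.eq_bot_or_eq_top _ hf.isSub_ker).resolve_right fun h => hz ?_
    rw [← LinearMap.mem_ker, h]
    trivial
  have hrange : LinearMap.range f = ⊤ := by
    refine (hM'.eq_bot_or_eq_top _ hf.isSub_range).resolve_left fun h => hz ?_
    have : f z ∈ LinearMap.range f := ⟨z, rfl⟩
    rwa [h] at this
  let e : V ≃ₗ[k] V' := LinearEquiv.ofBijective f
    ⟨LinearMap.ker_eq_bot.mp hker, LinearMap.range_eq_top.mp hrange⟩
  have he : ∀ y, f (e.symm y) = y := e.apply_symm_apply
  refine ⟨e.symm, fun h y => ?_, fun y => ?_⟩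
  · apply e.injective
    change f _ = f _
    rw [he, hf.act, he]
  · conv_lhs => rw [← he y, ← hf.coact, ← LinearMap.comp_apply, ← LinearMap.lTensor_comp]
    have : e.symm.toLinearMap ∘ₗ f = LinearMap.id := LinearMap.ext e.symm_apply_apply
    rw [this, LinearMap.lTensor_id]
    rfl

theorem Iso.exists_isHom {M : YDData k H V} {M' : YDData k H V'} (h : M.Iso M') :
    ∃ f : V' →ₗ[k] V, IsHom M' M f ∧ Function.Bijective f := by
  obtain ⟨e, h1, h2⟩ := h
  refine ⟨e.symm.toLinearMap, ⟨fun a y => ?_, fun y => ?_⟩, e.symm.bijective⟩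
  · apply e.injective
    simp [h1]
  · have h3 := h2 (e.symm y)
    rw [e.apply_symm_apply] at h3
    rw [← h3, ← LinearMap.comp_apply, ← LinearMap.lTensor_comp]
    simp

end General

end YDData

namespace InfTaft

open YDData

/-! ### Compatibility reduces to the generators g and x -/

section Twist

variable {k : Type u} [Field k] {n t : ℕ} [NeZero n] {ξ : k}
variable {V : Type*} [AddCommGroup V] [Module k V]

/-- Holds because S reverses products. Hence the elements h that satisfy the compatibility for all
vectors are closed under multiplication. -/
theorem twist_mul (M : YDData k (Taft n t ξ) V)
    (a b : Taft n t ξ ⊗[k] (Taft n t ξ ⊗[k] Taft n t ξ)) :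
    M.twist (a * b) = M.twist a * M.twist b := by
  refine LinearMap.congr_fun₂ (f := (LinearMap.mul k _).compr₂ M.twist)
    (g := (LinearMap.mul k _).compl₁₂ M.twist M.twist) ?_ a b
  ext a₁ a₂ a₃ b₁ b₂ b₃ y z
  simp [twist_tmul, antipode_mul, mul_assoc]

/-- The iterated comultiplication, as an algebra map. -/
def comul₂ (n t : ℕ) [NeZero n] (ξ : k) :
    Taft n t ξ →ₐ[k] Taft n t ξ ⊗[k] (Taft n t ξ ⊗[k] Taft n t ξ) :=
  (Algebra.TensorProduct.map (AlgHom.id k _) (Bialgebra.comulAlgHom k (Taft n t ξ))).comp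
    (Bialgebra.comulAlgHom k (Taft n t ξ))

theorem comul₂_apply (h : Taft n t ξ) : comul₂ n t ξ h =
    (Coalgebra.comul (R := k)).lTensor _ (Coalgebra.comul (R := k) h) := rfl

theorem comul_g_pow (m : ℕ) :
    Coalgebra.comul (R := k) (g n t ξ ^ m) = (g n t ξ ^ m) ⊗ₜ[k] (g n t ξ ^ m) := by
  rw [Bialgebra.comul_pow, comul_g, Algebra.TensorProduct.tmul_pow]

theorem twist_comul₂_g (M : YDData k (Taft n t ξ) V) (y : Taft n t ξ) (z : V) :
    M.twist (comul₂ n t ξ (g n t ξ)) (y ⊗ₜ[k] z) =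
      (g n t ξ * y * gz n t ξ (-1)) ⊗ₜ[k] M.act (g n t ξ) z := by
  rw [comul₂_apply, comul_g, LinearMap.lTensor_tmul, comul_g, twist_tmul, antipode_g]

theorem twist_comul₂_x (M : YDData k (Taft n t ξ) V) (y : Taft n t ξ) (z : V) :
    M.twist (comul₂ n t ξ (x n t ξ)) (y ⊗ₜ[k] z) =
      (x n t ξ * y * gz n t ξ (-(t : ℤ))) ⊗ₜ[k] M.act (g n t ξ ^ t) z +
      (y * gz n t ξ (-(t : ℤ))) ⊗ₜ[k] M.act (x n t ξ) z +
      (y * HopfAlgebra.antipode k (x n t ξ)) ⊗ₜ[k] z := by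
  rw [comul₂_apply, comul_x, map_add, LinearMap.lTensor_tmul, LinearMap.lTensor_tmul, comul_x,
    comul_g_pow, TensorProduct.tmul_add, map_add, map_add, LinearMap.add_apply,
    LinearMap.add_apply, twist_tmul, twist_tmul, twist_tmul, antipode_g_pow]
  simp [add_assoc]

theorem compat_of_generators (M : YDData k (Taft n t ξ) V)
    (hg : ∀ z, M.coact (M.act (g n t ξ) z) = M.twist (comul₂ n t ξ (g n t ξ)) (M.coact z))
    (hx : ∀ z, M.coact (M.act (x n t ξ) z) = M.twist (comul₂ n t ξ (x n t ξ)) (M.coact z))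
    (h : Taft n t ξ) (z : V) :
    M.coact (M.act h z) = M.twist (comul₂ n t ξ h) (M.coact z) := by
  induction h using induction_taft generalizing z with
  | hc r =>
    have h1 : M.twist 1 = 1 := by
      ext y z
      simp [Algebra.TensorProduct.one_def, twist_tmul]
    rw [AlgHom.commutes, AlgHom.commutes, Algebra.algebraMap_eq_smul_one,
      Algebra.algebraMap_eq_smul_one, map_smul, h1]
    simp
  | hg => exact hg z
  | hx => exact hx z
  | ha a b h1 h2 => simp only [map_add, LinearMap.add_apply, h1, h2]
  | hm a b h1 h2 =>
    simp only [map_mul, Module.End.mul_apply, h1, h2, twist_mul]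

end Twist

/-! ### Yetter–Drinfeld modules generated under x by a grouplike vector -/

section Generated

variable {k : Type u} [Field k] {n t : ℕ} [NeZero n] {ξ : k}
variable {V : Type*} [AddCommGroup V] [Module k V]

theorem comul_gz (e : ℤ) :
    Coalgebra.comul (R := k) (gz n t ξ e) = gz n t ξ e ⊗ₜ[k] gz n t ξ e := by
  rw [gz_eq_pow_val, comul_g_pow]

theorem counit_gz (e : ℤ) : Coalgebra.counit (R := k) (gz n t ξ e) = 1 := by
  rw [gz_eq_pow_val, Bialgebra.counit_pow, counit_g, one_pow]

/-- The operator on `H ⊗ H ⊗ V` by which `x` acts on twice iterated coactions. -/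
def twist₂X (M : YDData k (Taft n t ξ) V) :
    Module.End k (Taft n t ξ ⊗[k] (Taft n t ξ ⊗[k] V)) :=
  TensorProduct.map
      (LinearMap.mulLeft k (x n t ξ) ∘ₗ LinearMap.mulRight k (gz n t ξ (-(t : ℤ))))
      (TensorProduct.map
        (LinearMap.mulLeft k (g n t ξ ^ t) ∘ₗ LinearMap.mulRight k (gz n t ξ (-(t : ℤ))))
        (M.act (g n t ξ ^ t))) +
    TensorProduct.map (LinearMap.mulRight k (gz n t ξ (-(t : ℤ))))
      (M.twist (comul₂ n t ξ (x n t ξ))) +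
    TensorProduct.map (LinearMap.mulRight k (HopfAlgebra.antipode k (x n t ξ))) LinearMap.id

theorem twist_comul₂_g_pow (M : YDData k (Taft n t ξ) V) (m : ℕ) :
    M.twist (comul₂ n t ξ (g n t ξ ^ m)) = TensorProduct.map
      (LinearMap.mulLeft k (g n t ξ ^ m) ∘ₗ LinearMap.mulRight k (gz n t ξ (-(m : ℤ))))
      (M.act (g n t ξ ^ m)) := by
  refine TensorProduct.ext' fun y z => ?_
  rw [comul₂_apply, comul_g_pow, LinearMap.lTensor_tmul, comul_g_pow, twist_tmul, antipode_g_pow,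
    mul_assoc]
  rfl

/-- With `comul_twist_x`: x transforms (id ⊗ δ)δ and (Δ ⊗ id)δ by the same operator, so
coassociativity at a vector passes to its image under x. -/
theorem coact_twist_x (M : YDData k (Taft n t ξ) V)
    (hM : ∀ h z, M.coact (M.act h z) = M.twist (comul₂ n t ξ h) (M.coact z))
    (u : Taft n t ξ ⊗[k] V) :
    M.coact.lTensor _ (M.twist (comul₂ n t ξ (x n t ξ)) u) =
      twist₂X M (M.coact.lTensor _ u) := by
  induction u using TensorProduct.induction_on with
  | zero => simp
  | tmul a z =>
    simp only [twist_comul₂_x, map_add, LinearMap.lTensor_tmul, hM, twist₂X, LinearMap.add_apply,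
      TensorProduct.map_tmul, ← twist_comul₂_g_pow]
    simp [mul_assoc]
  | add p q hp hq => simp only [map_add, hp, hq]

theorem comul_twist_x (M : YDData k (Taft n t ξ) V) (u : Taft n t ξ ⊗[k] V) :
    TensorProduct.assoc k _ _ _ ((Coalgebra.comul (R := k)).rTensor V
        (M.twist (comul₂ n t ξ (x n t ξ)) u)) =
      twist₂X M (TensorProduct.assoc k _ _ _ ((Coalgebra.comul (R := k)).rTensor V u)) := by
  induction u using TensorProduct.induction_on with
  | zero => simp
  | tmul a z =>
    simp only [twist_comul₂_x, map_add, LinearMap.rTensor_tmul, Bialgebra.comul_mul, antipode_x,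
      map_neg, comul_x, comul_gz]
    generalize Coalgebra.comul (R := k) a = D
    induction D using TensorProduct.induction_on with
    | zero => simp
    | tmul b c =>
      simp [twist₂X, twist_comul₂_x, add_mul, mul_add, TensorProduct.add_tmul,
        TensorProduct.tmul_add, antipode_x, mul_assoc, ← gz_natCast, gz_mul_neg_self,
        TensorProduct.neg_tmul, TensorProduct.tmul_neg]
      abel
    | add p q hp hq =>
      simp only [add_mul, mul_add, TensorProduct.add_tmul, map_add] at hp hq ⊢
      rw [← hp, ← hq]
      simp only [neg_add, map_add, mul_add, TensorProduct.add_tmul]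
      abel
  | add p q hp hq => simp only [map_add, hp, hq]

theorem counit_twist_x (M : YDData k (Taft n t ξ) V) (u : Taft n t ξ ⊗[k] V) :
    TensorProduct.lid k V ((Coalgebra.counit (R := k)).rTensor V
        (M.twist (comul₂ n t ξ (x n t ξ)) u)) =
      M.act (x n t ξ) (TensorProduct.lid k V ((Coalgebra.counit (R := k)).rTensor V u)) := by
  induction u using TensorProduct.induction_on with
  | zero => simp
  | tmul a z =>
    simp [twist_comul₂_x, antipode_x, counit_x, counit_gz]
  | add p q hp hq => simp only [map_add, hp, hq]

theorem span_le_of_x_stable {M : YDData k (Taft n t ξ) V} {z : V} {W : Submodule k V} (hz : z ∈ W)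
    (hx : ∀ y ∈ W, M.act (x n t ξ) y ∈ W) :
    Submodule.span k (Set.range fun m : ℕ => M.act (x n t ξ ^ m) z) ≤ W := by
  rw [Submodule.span_le]
  rintro _ ⟨m, rfl⟩
  induction m with
  | zero => simpa using hz
  | succ m ih =>
    dsimp only
    rw [pow_succ', map_mul]
    exact hx _ ih

/-- The vectors at which coassociativity (or counitality) holds form an x-stable subspace that
contains z, hence the whole space. -/
theorem isYetterDrinfeld_of_generator {M : YDData k (Taft n t ξ) V}
    (hg : ∀ z, M.coact (M.act (g n t ξ) z) = M.twist (comul₂ n t ξ (g n t ξ)) (M.coact z))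
    (hx : ∀ z, M.coact (M.act (x n t ξ) z) = M.twist (comul₂ n t ξ (x n t ξ)) (M.coact z))
    {i : ℤ} {z : V} (hz : M.coact z = gz n t ξ i ⊗ₜ[k] z)
    (hspan : Submodule.span k (Set.range fun m : ℕ => M.act (x n t ξ ^ m) z) = ⊤) :
    M.IsYetterDrinfeld := by
  have hM := compat_of_generators M hg hx
  refine ⟨?_, ?_, hM⟩
  · rw [← LinearMap.eqLocus_eq_top, eq_top_iff, ← hspan]
    refine span_le_of_x_stable ?_ fun y hy => ?_
    · simp [hz, comul_gz]
    · simp only [LinearMap.mem_eqLocus, LinearMap.comp_apply, LinearEquiv.coe_coe] at hy ⊢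
      rw [hM, coact_twist_x M hM, comul_twist_x, hy]
  · rw [← LinearMap.eqLocus_eq_top, eq_top_iff, ← hspan]
    refine span_le_of_x_stable ?_ fun y hy => ?_
    · simp [hz, counit_gz]
    · simp only [LinearMap.mem_eqLocus, LinearMap.comp_apply, LinearEquiv.coe_coe] at hy ⊢
      rw [hM, counit_twist_x, hy]
      rfl

end Generated

/-! ### The effect of g and x on weight vectors -/

section Weight

variable {k : Type u} [Field k] {n t : ℕ} [NeZero n] {ξ : k}
variable {V : Type*} [AddCommGroup V] [Module k V] {V' : Type*} [AddCommGroup V'] [Module k V']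

/-- `z` spans a subcomodule of type `g ^ i` and has `g`-eigenvalue `ξ ^ j`. -/
structure IsWeight (M : YDData k (Taft n t ξ) V) (i j : ℤ) (z : V) : Prop where
  coact : M.coact z = gz n t ξ i ⊗ₜ[k] z
  act_g : M.act (g n t ξ) z = ξ ^ j • z

theorem act_g_act_x (M : YDData k (Taft n t ξ) V) (hξ : ξ ≠ 0) (z : V) :
    M.act (g n t ξ) (M.act (x n t ξ) z) = ξ⁻¹ • M.act (x n t ξ) (M.act (g n t ξ) z) := by
  have h := congrArg (fun a => M.act a z) (x_mul_g n t ξ)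
  simp only [map_mul, map_smul, Module.End.mul_apply, LinearMap.smul_apply] at h
  rw [h, smul_smul, inv_mul_cancel₀ hξ, one_smul]

theorem act_g_act_x_pow (M : YDData k (Taft n t ξ) V) (hξ : ξ ≠ 0) {j : ℤ} {z : V}
    (hz : M.act (g n t ξ) z = ξ ^ j • z) (m : ℕ) :
    M.act (g n t ξ) (M.act (x n t ξ ^ m) z) = ξ ^ (j - m) • M.act (x n t ξ ^ m) z := by
  induction m with
  | zero => simpa using hz
  | succ m ih =>
    rw [pow_succ', map_mul, Module.End.mul_apply, act_g_act_x M hξ, ih, map_smul, smul_smul,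
      ← zpow_neg_one, ← zpow_add₀ hξ]
    congr 2
    push_cast
    ring

theorem act_g_pow (M : YDData k (Taft n t ξ) V) {j : ℤ} {z : V}
    (hz : M.act (g n t ξ) z = ξ ^ j • z) (m : ℕ) :
    M.act (g n t ξ ^ m) z = ξ ^ ((m : ℤ) * j) • z := by
  have h : ∀ m : ℕ, M.act (g n t ξ ^ m) z = (ξ ^ j) ^ m • z := by
    intro m
    induction m with
    | zero => simp
    | succ m ih =>
      rw [pow_succ', map_mul, Module.End.mul_apply, ih, map_smul, hz, smul_smul, pow_succ]
  rw [h, ← zpow_natCast, ← zpow_mul, mul_comm]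

/-- The recursion for c is made for this: of the three terms of the iterated coproduct of x, the two
outer ones keep y l (collected in `F`) and the middle one moves it to y (l + 1) (collected in `G`).
The family y is arbitrary, so the formula serves both to derive coactions and to verify the
compatibility of the explicit modules. -/
theorem sum_step (M : YDData k (Taft n t ξ) V) (i j : ℤ) (m : ℕ) (y : ℕ → V)
    (hy : ∀ l ≤ m, M.act (g n t ξ) (y l) = ξ ^ (j - l) • y l)
    (hy' : ∀ l ≤ m, M.act (x n t ξ) (y l) = y (l + 1)) :
    M.twist (comul₂ n t ξ (x n t ξ))
        (∑ l ∈ Finset.range (m + 1), c n t ξ i j m l ⊗ₜ[k] y l) =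
      ∑ l ∈ Finset.range (m + 2), c n t ξ i j (m + 1) l ⊗ₜ[k] y l := by
  set F : ℕ → Taft n t ξ ⊗[k] V := fun l =>
    (c n t ξ i j m l * HopfAlgebra.antipode k (x n t ξ) + ξ ^ ((t : ℤ) * (j - (l : ℤ))) •
      (x n t ξ * c n t ξ i j m l * HopfAlgebra.antipode k (g n t ξ ^ t))) ⊗ₜ[k] y l with hF
  set G : ℕ → Taft n t ξ ⊗[k] V := fun l =>
    (c n t ξ i j m l * HopfAlgebra.antipode k (g n t ξ ^ t)) ⊗ₜ[k] y (l + 1) with hG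
  have h1 : ∀ l ∈ Finset.range (m + 1), M.twist (comul₂ n t ξ (x n t ξ))
      (c n t ξ i j m l ⊗ₜ[k] y l) = F l + G l := by
    intro l hl
    have hl' : l ≤ m := by simpa [Nat.lt_succ_iff] using hl
    rw [twist_comul₂_x, act_g_pow M (hy l hl'), hy' l hl', hF, hG]
    dsimp only
    rw [antipode_g_pow, TensorProduct.tmul_smul, TensorProduct.add_tmul, TensorProduct.smul_tmul']
    abel
  have h2 : ∀ l, c n t ξ i j (m + 1) (l + 1) ⊗ₜ[k] y (l + 1) = F (l + 1) + G l := fun l => by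
    rw [c_succ_succ, TensorProduct.add_tmul]
  have h3 : c n t ξ i j (m + 1) 0 ⊗ₜ[k] y 0 = F 0 := by
    rw [c_succ_zero, hF]
    simp
  have h4 : F (m + 1) = 0 := by
    rw [hF]
    simp [c_of_lt t i j (Nat.lt_succ_self m)]
  rw [map_sum, Finset.sum_congr rfl h1, Finset.sum_add_distrib, Finset.sum_range_succ' _ (m + 1)]
  simp only [h2, h3]
  have h5 := Finset.sum_range_succ' F (m + 1)
  rw [Finset.sum_range_succ, h4, add_zero] at h5
  rw [Finset.sum_add_distrib, h5]
  abel

end Weight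

/-! ### Existence and propagation of weight vectors -/

section WeightVectors

variable {k : Type u} [Field k] {n t : ℕ} [NeZero n] {ξ : k}
variable {V : Type*} [AddCommGroup V] [Module k V] {V' : Type*} [AddCommGroup V'] [Module k V']

theorem _root_.YDData.IsYetterDrinfeld.compat_comul₂ {M : YDData k (Taft n t ξ) V}
    (hM : M.IsYetterDrinfeld) (h : Taft n t ξ) (z : V) :
    M.coact (M.act h z) = M.twist (comul₂ n t ξ h) (M.coact z) := hM.compat h z

theorem act_x_pow_succ (M : YDData k (Taft n t ξ) V) (m : ℕ) (z : V) :
    M.act (x n t ξ ^ (m + 1)) z = M.act (x n t ξ) (M.act (x n t ξ ^ m) z) := by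
  rw [pow_succ', map_mul, Module.End.mul_apply]

theorem act_x_pow_add (M : YDData k (Taft n t ξ) V) (m l : ℕ) (z : V) :
    M.act (x n t ξ ^ (m + l)) z = M.act (x n t ξ ^ m) (M.act (x n t ξ ^ l) z) := by
  rw [pow_add, map_mul, Module.End.mul_apply]

theorem IsWeight.coact_x_pow {M : YDData k (Taft n t ξ) V} (hM : M.IsYetterDrinfeld)
    (hξ : ξ ≠ 0) {i j : ℤ} {z : V} (hz : IsWeight M i j z) (m : ℕ) :
    M.coact (M.act (x n t ξ ^ m) z) =
      ∑ l ∈ Finset.range (m + 1), c n t ξ i j m l ⊗ₜ[k] M.act (x n t ξ ^ l) z := by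
  induction m with
  | zero => simp [c_zero_zero, hz.coact]
  | succ m ih =>
    rw [act_x_pow_succ, hM.compat_comul₂, ih]
    exact sum_step M i j m (fun l => M.act (x n t ξ ^ l) z)
      (fun l _ => act_g_act_x_pow M hξ hz.act_g l) (fun l _ => (act_x_pow_succ M l z).symm)

theorem IsWeight.congr {M : YDData k (Taft n t ξ) V} (hξ : IsPrimitiveRoot ξ n) {i j i' j' : ℤ}
    {z : V} (hz : IsWeight M i j z) (hi : i ≡ i' [ZMOD (n : ℤ)]) (hj : j ≡ j' [ZMOD (n : ℤ)]) :
    IsWeight M i' j' z where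
  coact := by rw [← gz_congr t hi]; exact hz.coact
  act_g := by
    obtain ⟨e, he⟩ := hj.dvd
    rw [show j' = j + n * e by linarith, zpow_add₀ (hξ.ne_zero (NeZero.ne n)), zpow_mul,
      zpow_natCast, hξ.pow_eq_one, one_zpow, mul_one]
    exact hz.act_g

theorem IsWeight.x_pow {M : YDData k (Taft n t ξ) V} (hM : M.IsYetterDrinfeld)
    (hξ : ξ ≠ 0) {i j : ℤ} {z : V} (hz : IsWeight M i j z) {p : ℕ}
    (hp : ∀ l < p, c n t ξ i j p l = 0) :
    IsWeight M (i - t * p) (j - p) (M.act (x n t ξ ^ p) z) where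
  coact := by
    rw [hz.coact_x_pow hM hξ, Finset.sum_range_succ, Finset.sum_eq_zero, zero_add, c_eq hξ,
      alpha_self]
    · simp
    · intro l hl
      rw [hp l (Finset.mem_range.mp hl), TensorProduct.zero_tmul]
  act_g := act_g_act_x_pow M hξ hz.act_g p

theorem zpow_eq_zpow_iff (hξ : IsPrimitiveRoot ξ n) (a b : ℤ) :
    ξ ^ a = ξ ^ b ↔ a ≡ b [ZMOD (n : ℤ)] := by
  have h0 := hξ.ne_zero (NeZero.ne n)
  rw [Int.modEq_comm, Int.modEq_iff_dvd, ← hξ.zpow_eq_one_iff_dvd, zpow_sub₀ h0,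
    div_eq_one_iff_eq (zpow_ne_zero _ h0)]

theorem isPrimitiveRoot_ordN (t : ℕ) (ξ : k) : IsPrimitiveRoot (ξ ^ t) (ordN t ξ) :=
  IsPrimitiveRoot.orderOf _

theorem ordN_dvd (hξ : IsPrimitiveRoot ξ n) (t : ℕ) : ordN t ξ ∣ n :=
  orderOf_dvd_of_pow_eq_one (by rw [← pow_mul, mul_comm, pow_mul, hξ.pow_eq_one, one_pow])

theorem ordN_pos (hξ : IsPrimitiveRoot ξ n) (t : ℕ) : 0 < ordN t ξ :=
  Nat.pos_of_dvd_of_pos (ordN_dvd hξ t) (NeZero.pos n)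

theorem mul_modEq_iff (hξ : IsPrimitiveRoot ξ n) (t : ℕ) (a b : ℤ) :
    (t : ℤ) * a ≡ t * b [ZMOD (n : ℤ)] ↔ a ≡ b [ZMOD (ordN t ξ : ℤ)] := by
  have : NeZero (ordN t ξ) := ⟨(ordN_pos hξ t).ne'⟩
  rw [← zpow_eq_zpow_iff hξ, zpow_mul, zpow_mul, zpow_natCast,
    zpow_eq_zpow_iff (isPrimitiveRoot_ordN t ξ)]

theorem IsWeight.x_pow_of_modEq {M : YDData k (Taft n t ξ) V} (hM : M.IsYetterDrinfeld)
    (hξ : IsPrimitiveRoot ξ n) {i j : ℤ} {z : V} (hz : IsWeight M (t * i) j z) {p : ℕ}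
    (hp0 : 0 < p) (hp : (p : ℤ) ≡ i + j + 1 [ZMOD (ordN t ξ : ℤ)]) :
    IsWeight M (t * (i - p)) (j - p) (M.act (x n t ξ ^ p) z) := by
  have h0 := hξ.ne_zero (NeZero.ne n)
  rw [mul_sub]
  refine hz.x_pow hM h0 fun l hl => ?_
  obtain ⟨p, rfl⟩ := Nat.exists_eq_succ_of_ne_zero hp0.ne'
  have h : ξ ^ ((t : ℤ) * (j - p)) = ξ ^ (-((t : ℤ) * i)) := by
    rw [← mul_neg, zpow_eq_zpow_iff hξ, mul_modEq_iff hξ, Int.modEq_iff_dvd]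
    have := hp.dvd
    push_cast at this
    rw [← dvd_neg]
    rwa [show -(-i - (j - (p : ℤ))) = i + j + 1 - (p + 1) by ring]
  rw [c_eq h0, alpha_eq_zero t h0 _ _ (Nat.lt_succ_iff.mp hl) h, zero_smul]

/-- No Gaussian binomial has to be evaluated at a root of unity. Write m = p + (m - p) with 1 ≤ p ≤
N and p ≡ i + j + 1 mod N; the new weight (t(i-p), j-p) satisfies (i-p) + (j-p) + 1 ≡ -p ≡ m - p, so
`x_pow_of_modEq` applies a second time. -/
theorem IsWeight.x_pow_of_dvd {M : YDData k (Taft n t ξ) V} (hM : M.IsYetterDrinfeld)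
    (hξ : IsPrimitiveRoot ξ n) {i j : ℤ} {z : V} (hz : IsWeight M (t * i) j z) {m : ℕ}
    (hm : ordN t ξ ∣ m) :
    IsWeight M (t * i) (j - m) (M.act (x n t ξ ^ m) z) := by
  have hN := ordN_pos hξ t
  rcases Nat.eq_zero_or_pos m with rfl | hm0
  · simpa using hz
  have hcong : ((t : ℤ) * (i - m)) ≡ t * i [ZMOD (n : ℤ)] := by
    rw [mul_modEq_iff hξ, Int.modEq_iff_dvd]
    simpa using Int.natCast_dvd_natCast.mpr hm
  obtain ⟨p, hp0, hpN, hp⟩ : ∃ p : ℕ, 0 < p ∧ p ≤ ordN t ξ ∧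
      (p : ℤ) ≡ i + j + 1 [ZMOD (ordN t ξ : ℤ)] := by
    refine ⟨((i + j) % (ordN t ξ : ℤ)).toNat + 1, by omega, ?_, ?_⟩
    · have := Int.emod_lt_of_pos (i + j) (Int.natCast_pos.mpr hN)
      omega
    · push_cast
      rw [Int.toNat_of_nonneg (Int.emod_nonneg _ (by omega))]
      exact (Int.mod_modEq _ _).add_right 1
  have h1 := hz.x_pow_of_modEq hM hξ hp0 hp
  have hpm : p ≤ m := hpN.trans (Nat.le_of_dvd hm0 hm)
  rcases hpm.eq_or_lt with rfl | hlt
  · exact h1.congr hξ hcong (Int.ModEq.refl _)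
  · have h2 := h1.x_pow_of_modEq hM hξ (p := m - p) (by omega) (by
      rw [Nat.cast_sub hpm, Int.modEq_iff_dvd]
      have e1 := hp.dvd
      have e2 : (ordN t ξ : ℤ) ∣ m := Int.natCast_dvd_natCast.mpr hm
      have := dvd_sub e1 e2
      rwa [show i - p + (j - p) + 1 - (m - p : ℤ) = i + j + 1 - p - m by ring])
    rw [← act_x_pow_add, Nat.sub_add_cancel hpm, Nat.cast_sub hpm] at h2
    refine h2.congr hξ ?_ ?_
    · rw [show i - p - (m - p : ℤ) = i - m by ring]; exact hcong
    · rw [show j - p - (m - p : ℤ) = j - m by ring]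

/-- The span of the `x ^ m z`. -/
def cyclic (M : YDData k (Taft n t ξ) V) (z : V) : Submodule k V :=
  Submodule.span k (Set.range fun m : ℕ => M.act (x n t ξ ^ m) z)

theorem x_pow_mem_cyclic (M : YDData k (Taft n t ξ) V) (z : V) (m : ℕ) :
    M.act (x n t ξ ^ m) z ∈ cyclic M z := Submodule.subset_span ⟨m, rfl⟩

theorem mem_cyclic (M : YDData k (Taft n t ξ) V) (z : V) : z ∈ cyclic M z := by
  simpa using x_pow_mem_cyclic M z 0

theorem act_mem_of_generators {M : YDData k (Taft n t ξ) V} {W : Submodule k V}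
    (hg : ∀ y ∈ W, M.act (g n t ξ) y ∈ W) (hx : ∀ y ∈ W, M.act (x n t ξ) y ∈ W)
    (h : Taft n t ξ) (y : V) (hy : y ∈ W) : M.act h y ∈ W := by
  induction h using induction_taft generalizing y with
  | hc r => rw [AlgHom.commutes]; exact W.smul_mem r hy
  | hg => exact hg y hy
  | hx => exact hx y hy
  | ha a b h1 h2 => rw [map_add]; exact W.add_mem (h1 y hy) (h2 y hy)
  | hm a b h1 h2 => rw [map_mul]; exact h1 _ (h2 y hy)

theorem IsWeight.isSub_cyclic {M : YDData k (Taft n t ξ) V} (hM : M.IsYetterDrinfeld)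
    (hξ : ξ ≠ 0) {i j : ℤ} {z : V} (hz : IsWeight M i j z) : M.IsSub (cyclic M z) where
  act_mem := by
    have hle : ∀ f : Module.End k V, (∀ m, f (M.act (x n t ξ ^ m) z) ∈ cyclic M z) →
        ∀ y ∈ cyclic M z, f y ∈ cyclic M z := by
      intro f hf y hy
      have : cyclic M z ≤ (cyclic M z).comap f := by
        refine Submodule.span_le.mpr ?_
        rintro _ ⟨m, rfl⟩
        exact hf m
      exact this hy
    refine act_mem_of_generators (hle _ fun m => ?_) (hle _ fun m => ?_)
    · rw [act_g_act_x_pow M hξ hz.act_g]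
      exact Submodule.smul_mem _ _ (x_pow_mem_cyclic M z m)
    · rw [← act_x_pow_succ]
      exact x_pow_mem_cyclic M z (m + 1)
  coact_mem := by
    have : cyclic M z ≤ (LinearMap.range ((cyclic M z).subtype.lTensor (Taft n t ξ))).comap
        M.coact := by
      refine Submodule.span_le.mpr ?_
      rintro _ ⟨m, rfl⟩
      rw [SetLike.mem_coe, Submodule.mem_comap, hz.coact_x_pow hM hξ]
      refine Submodule.sum_mem _ fun l _ => ?_
      exact ⟨c n t ξ i j m l ⊗ₜ[k] ⟨_, x_pow_mem_cyclic M z l⟩, by simp⟩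
    exact this

theorem isHom_of_generators {M : YDData k (Taft n t ξ) V} {M' : YDData k (Taft n t ξ) V'}
    {f : V →ₗ[k] V'} (hg : ∀ z, f (M.act (g n t ξ) z) = M'.act (g n t ξ) (f z))
    (hx : ∀ z, f (M.act (x n t ξ) z) = M'.act (x n t ξ) (f z))
    (hc : ∀ z, f.lTensor _ (M.coact z) = M'.coact (f z)) : IsHom M M' f where
  act h z := by
    induction h using induction_taft generalizing z with
    | hc r => simp
    | hg => exact hg z
    | hx => exact hx z
    | ha a b h1 h2 => simp [h1, h2]
    | hm a b h1 h2 => simp [h1, h2]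
  coact := hc

theorem IsWeight.map {M : YDData k (Taft n t ξ) V} {M' : YDData k (Taft n t ξ) V'}
    {f : V →ₗ[k] V'} (hf : IsHom M M' f) {i j : ℤ} {z : V} (hz : IsWeight M i j z) :
    IsWeight M' i j (f z) where
  coact := by rw [← hf.coact, hz.coact, LinearMap.lTensor_tmul]
  act_g := by rw [← hf.act, hz.act_g, map_smul]

theorem IsWeight.smul {M : YDData k (Taft n t ξ) V} {i j : ℤ} {z : V} (hz : IsWeight M i j z)
    (r : k) : IsWeight M i j (r • z) where
  coact := by rw [map_smul, hz.coact, TensorProduct.tmul_smul]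
  act_g := by rw [map_smul, hz.act_g, smul_comm]

/-- In Δ(x^b g^a') the only term whose left factor has x-degree b is x^b g^a' ⊗ g^(tb+a'). -/
theorem contr_coeff_comul (hξ : IsPrimitiveRoot ξ n) {b B : ℕ} (hb : b ≤ B) (a a' : ℤ) :
    contr (coeff hξ t B a) _ (Coalgebra.comul (R := k) (x n t ξ ^ b * gz n t ξ a')) =
      if b = B ∧ a' ≡ a [ZMOD (n : ℤ)] then gz n t ξ (t * B + a) else 0 := by
  have h0 : ∀ u : Taft n t ξ ⊗[k] Taft n t ξ, contr (coeff hξ t 0 a) _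
      ((x n t ξ ⊗ₜ[k] (g n t ξ ^ t) + 1 ⊗ₜ[k] x n t ξ) * u) =
        x n t ξ * contr (coeff hξ t 0 a) _ u := by
    intro u
    induction u using TensorProduct.induction_on with
    | zero => simp
    | tmul p q => simp [add_mul, coeff_zero_x_mul]
    | add p q hp hq => simp only [mul_add, map_add, hp, hq]
  have h1 : ∀ (B : ℕ) (u : Taft n t ξ ⊗[k] Taft n t ξ), contr (coeff hξ t (B + 1) a) _
      ((x n t ξ ⊗ₜ[k] (g n t ξ ^ t) + 1 ⊗ₜ[k] x n t ξ) * u) =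
        g n t ξ ^ t * contr (coeff hξ t B a) _ u + x n t ξ * contr (coeff hξ t (B + 1) a) _ u := by
    intro B u
    induction u using TensorProduct.induction_on with
    | zero => simp
    | tmul p q => simp [add_mul, coeff_succ_x_mul]
    | add p q hp hq => simp only [mul_add, map_add, hp, hq]; abel
  induction b generalizing B with
  | zero =>
    rw [pow_zero, one_mul, comul_gz, contr_tmul, coeff_gz]
    by_cases h : 0 = B ∧ a' ≡ a [ZMOD (n : ℤ)]
    · rw [if_pos h, if_pos h, one_smul, ← h.1, gz_congr t h.2]
      simp
    · rw [if_neg h, if_neg h, zero_smul]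
  | succ b ih =>
    obtain ⟨B, rfl⟩ := Nat.exists_eq_succ_of_ne_zero (Nat.ne_zero_of_lt hb)
    rw [pow_succ', mul_assoc, Bialgebra.comul_mul, comul_x, Nat.succ_eq_add_one, h1,
      ih (by omega), ih (by omega), if_neg (c := b = B + 1 ∧ _) (by omega), mul_zero, add_zero,
      mul_ite, mul_zero, ← gz_natCast, ← gz_add]
    simp only [Nat.add_right_cancel_iff]
    congr 2
    push_cast
    ring

theorem exists_grouplike {M : YDData k (Taft n t ξ) V} (hM : M.IsYetterDrinfeld)
    (hξ : IsPrimitiveRoot ξ n) [Nontrivial V] :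
    ∃ (z : V) (i : ℤ), z ≠ 0 ∧ M.coact z = gz n t ξ i ⊗ₜ[k] z := by
  obtain ⟨z, hz⟩ := exists_ne (0 : V)
  obtain ⟨w, hw⟩ := TensorProduct.eq_repr_basis_left (pbw hξ t) (M.coact z)
  have hw0 : w.support.Nonempty := by
    rw [Finsupp.support_nonempty_iff]
    rintro rfl
    have h := LinearMap.congr_fun hM.counit z
    rw [LinearMap.comp_apply, LinearMap.comp_apply, ← hw] at h
    simp at h
    exact hz h.symm
  -- Choose a term x^B g^a ⊗ w of δ(z) with B maximal. Taking the coefficient of x^B g^a in the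
  -- first tensor factor of the coassociativity law gives g^(tB+a) ⊗ w on one side and δ(w) on the
  -- other.
  obtain ⟨⟨B, a⟩, hBa, hmax⟩ := Finset.exists_max_image w.support (fun p => p.1) hw0
  have hp : ∀ p : ℕ × ZMod n, pbw hξ t p = x n t ξ ^ p.1 * gz n t ξ (p.2.val : ℤ) := fun p => by
    rw [pbw_apply, gz_natCast]
  have h := congrArg (contr (coeff hξ t B (a.val : ℤ)) _) (LinearMap.congr_fun hM.coassoc z)
  simp only [LinearMap.comp_apply] at h
  rw [contr_lTensor, ← hw, Finsupp.sum, map_sum, map_sum, map_sum, map_sum] at h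
  have hR : ∀ p ∈ w.support, contr (coeff hξ t B (a.val : ℤ)) _ (pbw hξ t p ⊗ₜ[k] w p) =
      if p = (B, a) then w (B, a) else 0 := by
    intro p _
    have e : ((p.2.val : ℕ) : ℤ) ≡ (a.val : ℤ) [ZMOD (n : ℤ)] ↔ p.2 = a := by
      rw [← ZMod.intCast_eq_intCast_iff]; simp
    rw [contr_tmul, hp, coeff_x_pow_mul_gz]
    simp only [e, Prod.ext_iff, ite_smul, one_smul, zero_smul]
    refine if_ctx_congr Iff.rfl (fun h => ?_) fun _ => rfl
    rw [← h.1, ← h.2]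
  have hL : ∀ p ∈ w.support, contr (coeff hξ t B (a.val : ℤ)) _
      (TensorProduct.assoc k _ _ _ ((Coalgebra.comul (R := k)).rTensor V
        (pbw hξ t p ⊗ₜ[k] w p))) =
      if p = (B, a) then gz n t ξ (t * B + (a.val : ℤ)) ⊗ₜ[k] w (B, a) else 0 := by
    intro p hpw
    have e : ((p.2.val : ℕ) : ℤ) ≡ (a.val : ℤ) [ZMOD (n : ℤ)] ↔ p.2 = a := by
      rw [← ZMod.intCast_eq_intCast_iff]; simp
    rw [LinearMap.rTensor_tmul, contr_assoc, hp, contr_coeff_comul hξ (hmax p hpw),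
      TensorProduct.ite_tmul]
    simp only [e, Prod.ext_iff]
    refine if_ctx_congr Iff.rfl (fun h => ?_) fun _ => rfl
    rw [← h.1, ← h.2]
  simp only [LinearEquiv.coe_coe] at h
  rw [Finset.sum_congr rfl hR, Finset.sum_congr rfl hL, Finset.sum_ite_eq', if_pos hBa,
    Finset.sum_ite_eq',
    if_pos hBa] at h
  exact ⟨w (B, a), _, Finsupp.mem_support_iff.mp hBa, h.symm⟩

/-- Without an eigenvector in W every T - ξ^j is injective on W, yet their product over all n-th
roots of unity is T^n - 1 = 0. No finite dimension is needed. -/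
theorem exists_eigenvector_of_pow_eq_one (hξ : IsPrimitiveRoot ξ n) {T : Module.End k V}
    (hT : T ^ n = 1) {W : Submodule k V} (hW : ∀ y ∈ W, T y ∈ W) {z : V} (hz : z ∈ W)
    (hz0 : z ≠ 0) : ∃ y ∈ W, ∃ j : ℕ, y ≠ 0 ∧ T y = ξ ^ j • y := by
  by_contra! H
  have h : ∀ s : Finset k, (∀ μ ∈ s, ∃ j : ℕ, ξ ^ j = μ) → ∃ y ∈ W, y ≠ 0 ∧
      Polynomial.aeval T (∏ μ ∈ s, (Polynomial.X - Polynomial.C μ)) z = y := by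
    classical
    intro s
    induction s using Finset.induction_on with
    | empty => exact fun _ => ⟨z, hz, hz0, by simp⟩
    | insert μ s hμ ih =>
      intro hs
      obtain ⟨y, hy, hy0, e⟩ := ih fun ν hν => hs ν (Finset.mem_insert_of_mem hν)
      obtain ⟨j, rfl⟩ := hs μ (Finset.mem_insert_self μ s)
      refine ⟨T y - ξ ^ j • y, W.sub_mem (hW y hy) (W.smul_mem _ hy),
        sub_ne_zero.mpr (H y hy j hy0), ?_⟩
      rw [Finset.prod_insert hμ, map_mul, Module.End.mul_apply, e, map_sub, Polynomial.aeval_X,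
        Polynomial.aeval_C]
      rfl
  obtain ⟨y, -, hy0, e⟩ := h (Polynomial.nthRootsFinset n (1 : k)) fun μ hμ => by
    rw [Polynomial.mem_nthRootsFinset (NeZero.pos n)] at hμ
    obtain ⟨j, -, hj⟩ := hξ.eq_pow_of_pow_eq_one hμ
    exact ⟨j, hj⟩
  rw [← Polynomial.X_pow_sub_one_eq_prod (NeZero.pos n) hξ] at e
  apply hy0
  rw [← e]
  simp [hT]

end WeightVectors

/-! ### Detecting the generator of a cyclic module -/

section CyclicModules

variable {k : Type u} [Field k] {n t : ℕ} [NeZero n] {ξ : k}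
variable {V : Type*} [AddCommGroup V] [Module k V]

theorem sum_step_g (M : YDData k (Taft n t ξ) V) (hξ : ξ ≠ 0) (i j : ℤ) (m : ℕ) (y : ℕ → V)
    (hy : ∀ l ≤ m, M.act (g n t ξ) (y l) = ξ ^ (j - l) • y l) :
    M.twist (comul₂ n t ξ (g n t ξ))
        (∑ l ∈ Finset.range (m + 1), c n t ξ i j m l ⊗ₜ[k] y l) =
      ξ ^ (j - m) • ∑ l ∈ Finset.range (m + 1), c n t ξ i j m l ⊗ₜ[k] y l := by
  rw [map_sum, Finset.smul_sum]
  refine Finset.sum_congr rfl fun l hl => ?_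
  rw [twist_comul₂_g, hy l (Nat.lt_succ_iff.mp (Finset.mem_range.mp hl)), ← gz_one, gz_mul_c hξ,
    TensorProduct.tmul_smul, TensorProduct.smul_tmul', smul_smul, TensorProduct.smul_tmul',
    ← zpow_add₀ hξ]
  congr 3
  ring

theorem contr_coact_linearCombination {M : YDData k (Taft n t ξ) V} (hM : M.IsYetterDrinfeld)
    (hξ : IsPrimitiveRoot ξ n) {i j : ℤ} {z : V} (hz : IsWeight M i j z) (a : ℕ →₀ k) {K : ℕ}
    (hK : ∀ m ∈ a.support, m ≤ K) :
    contr (coeff hξ t K (i - t * K)) V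
        (M.coact (Finsupp.linearCombination k (fun m => M.act (x n t ξ ^ m) z) a)) =
      (a K * alpha t ξ i j K 0) • z := by
  rw [Finsupp.linearCombination_apply, Finsupp.sum, map_sum, map_sum]
  have h : ∀ m ∈ a.support, contr (coeff hξ t K (i - t * K)) V
      (M.coact (a m • M.act (x n t ξ ^ m) z)) =
      if m = K then (a K * alpha t ξ i j K 0) • z else 0 := by
    intro m hm
    rw [map_smul, map_smul, hz.coact_x_pow hM (hξ.ne_zero (NeZero.ne n)), map_sum]
    have h' : ∀ l ∈ Finset.range (m + 1), contr (coeff hξ t K (i - t * K)) V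
        (c n t ξ i j m l ⊗ₜ[k] M.act (x n t ξ ^ l) z) =
        if l = 0 then (if m = K then alpha t ξ i j K 0 • z else 0) else 0 := by
      intro l _
      rw [contr_tmul, coeff_c hξ t i j (hK m hm)]
      by_cases h1 : l = 0
      · subst h1
        by_cases h2 : m = K <;> simp [h2]
      · simp [h1]
    rw [Finset.sum_congr rfl h', Finset.sum_ite_eq', if_pos (by simp)]
    by_cases h2 : m = K
    · rw [if_pos h2, if_pos h2, h2, smul_smul]
    · rw [if_neg h2, if_neg h2, smul_zero]
  rw [Finset.sum_congr rfl h, Finset.sum_ite_eq']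
  split_ifs with h1
  · rfl
  · rw [Finsupp.notMem_support_iff.mp h1, zero_mul, zero_smul]

theorem exists_linearCombination {M : YDData k (Taft n t ξ) V} {z : V} {s : Set ℕ}
    (hspan : Submodule.span k ((fun m => M.act (x n t ξ ^ m) z) '' s) = ⊤) {y : V} (hy : y ≠ 0) :
    ∃ (a : ℕ →₀ k) (K : ℕ), K ∈ s ∧ a K ≠ 0 ∧ (∀ m ∈ a.support, m ≤ K) ∧
      Finsupp.linearCombination k (fun m => M.act (x n t ξ ^ m) z) a = y := by
  have h : y ∈ Submodule.span k ((fun m => M.act (x n t ξ ^ m) z) '' s) := by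
    rw [hspan]; trivial
  obtain ⟨a, ha, rfl⟩ := (Finsupp.mem_span_image_iff_linearCombination k).mp h
  have ha0 : a.support.Nonempty := by
    rw [Finsupp.support_nonempty_iff]
    rintro rfl
    simp at hy
  refine ⟨a, a.support.max' ha0, (Finsupp.mem_supported k a).mp ha (Finset.max'_mem _ ha0),
    Finsupp.mem_support_iff.mp (Finset.max'_mem _ ha0), fun m hm => Finset.le_max' _ m hm, rfl⟩

/-- Contracting the coaction of a non-zero vector with the functional for its top index K yields a
non-zero multiple of z, so every non-zero submodule contains z. -/
theorem isSimpleYD_of_alpha_ne_zero {M : YDData k (Taft n t ξ) V} (hM : M.IsYetterDrinfeld)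
    (hξ : IsPrimitiveRoot ξ n) {i j : ℤ} {z : V} (hz : IsWeight M i j z) (hz0 : z ≠ 0) {s : Set ℕ}
    (hspan : Submodule.span k ((fun m => M.act (x n t ξ ^ m) z) '' s) = ⊤)
    (hs : ∀ K ∈ s, alpha t ξ i j K 0 ≠ 0) : M.IsSimpleYD where
  isYetterDrinfeld := hM
  nontrivial := ⟨z, 0, hz0⟩
  eq_bot_or_eq_top W hW := by
    rw [or_iff_not_imp_left, Submodule.eq_bot_iff]
    intro h
    push Not at h
    obtain ⟨y, hy, hy0⟩ := h
    obtain ⟨a, K, hKs, haK, hK, rfl⟩ := exists_linearCombination hspan hy0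
    have h1 := hW.contr_mem (coeff hξ t K (i - t * K)) hy
    rw [contr_coact_linearCombination hM hξ hz a hK,
      W.smul_mem_iff (mul_ne_zero haK (hs K hKs))] at h1
    rw [eq_top_iff, ← hspan, Submodule.span_le]
    rintro _ ⟨m, -, rfl⟩
    exact hW.act_mem _ _ h1

/-- If the top index K of y were positive, the same functional would give a non-zero multiple of z,
whereas it kills g^r, which has x-degree 0. -/
theorem eq_smul_of_grouplike {M : YDData k (Taft n t ξ) V} (hM : M.IsYetterDrinfeld)
    (hξ : IsPrimitiveRoot ξ n) {i j : ℤ} {z : V} (hz : IsWeight M i j z) (hz0 : z ≠ 0) {s : Set ℕ}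
    (hspan : Submodule.span k ((fun m => M.act (x n t ξ ^ m) z) '' s) = ⊤)
    (hs : ∀ K ∈ s, alpha t ξ i j K 0 ≠ 0) {y : V} {r : ℤ}
    (hy : M.coact y = gz n t ξ r ⊗ₜ[k] y) : ∃ b : k, y = b • z := by
  by_cases hy0 : y = 0
  · exact ⟨0, by rw [hy0, zero_smul]⟩
  obtain ⟨a, K, hKs, haK, hK, e⟩ := exists_linearCombination hspan hy0
  have h1 := contr_coact_linearCombination hM hξ hz a hK
  rw [e, hy, contr_tmul, coeff_gz] at h1
  have hK0 : K = 0 := by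
    by_contra hK0
    rw [if_neg (fun h => hK0 h.1.symm), zero_smul, eq_comm, smul_eq_zero] at h1
    exact h1.elim (mul_ne_zero haK (hs K hKs)) hz0
  subst hK0
  refine ⟨a 0, ?_⟩
  have ha : a = Finsupp.single 0 (a 0) := by
    refine Finsupp.ext fun m => ?_
    rcases Nat.eq_zero_or_pos m with rfl | hm
    · simp
    · rw [Finsupp.single_eq_of_ne hm.ne', ← Finsupp.notMem_support_iff]
      exact fun h => absurd (hK m h) (by omega)
  rw [← e, ha]
  simp

theorem eq_of_grouplike (hξ : IsPrimitiveRoot ξ n) {z : V} (hz : z ≠ 0) {a b : ℤ}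
    (h : gz n t ξ a ⊗ₜ[k] z = gz n t ξ b ⊗ₜ[k] z) : a ≡ b [ZMOD (n : ℤ)] := by
  have h1 := congrArg (contr (coeff hξ t 0 b) V) h
  rw [contr_tmul, contr_tmul, coeff_gz, coeff_gz] at h1
  by_contra h2
  simp [h2, hz.symm] at h1

theorem IsWeight.modEq {M : YDData k (Taft n t ξ) V} (hξ : IsPrimitiveRoot ξ n) {i j r s : ℤ}
    {z : V} (hz : z ≠ 0) (h : IsWeight M i j z) (h' : IsWeight M r s z) :
    i ≡ r [ZMOD (n : ℤ)] ∧ j ≡ s [ZMOD (n : ℤ)] := by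
  refine ⟨eq_of_grouplike hξ (t := t) hz (h.coact.symm.trans h'.coact), ?_⟩
  rw [← zpow_eq_zpow_iff hξ]
  exact smul_left_injective k hz (h.act_g.symm.trans h'.act_g)

end CyclicModules

/-! ### The modules V(i, j) -/

section VInf

variable {k : Type u} [Field k] {n t : ℕ} [NeZero n] {ξ : k} (hξ : IsPrimitiveRoot ξ n) (i j : ℤ)

theorem VInf_act_g (a : ℕ) (r : k) : (VInf t hξ i j).act (g n t ξ) (Finsupp.single a r) =
    ξ ^ (j - a) • Finsupp.single a r := by
  simp [VInf, gOp_single, mul_comm]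

theorem VInf_act_x (a : ℕ) (r : k) : (VInf t hξ i j).act (x n t ξ) (Finsupp.single a r) =
    Finsupp.single (a + 1) r := by
  simp [VInf, xOpInf]

theorem VInf_act_x_pow (m a : ℕ) (r : k) :
    (VInf t hξ i j).act (x n t ξ ^ m) (Finsupp.single a r) = Finsupp.single (m + a) r := by
  induction m with
  | zero => simp
  | succ m ih => rw [act_x_pow_succ, ih, VInf_act_x, Nat.add_right_comm]

theorem VInf_coact (a : ℕ) (r : k) : (VInf t hξ i j).coact (Finsupp.single a r) =
    r • ∑ l ∈ Finset.range (a + 1), c n t ξ i j a l ⊗ₜ[k] Finsupp.single l 1 := by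
  simp [VInf]

theorem VInf_isWeight : IsWeight (VInf t hξ i j) i j (Finsupp.single 0 1) where
  coact := by simp [VInf_coact, c_zero_zero]
  act_g := by simp [VInf_act_g]

theorem VInf_span : Submodule.span k
    (Set.range fun m : ℕ => (VInf t hξ i j).act (x n t ξ ^ m) (Finsupp.single 0 1)) = ⊤ := by
  simp only [VInf_act_x_pow, add_zero]
  exact Finsupp.basisSingleOne.span_eq

theorem VInf_isYetterDrinfeld : (VInf t hξ i j).IsYetterDrinfeld := by
  have h0 := hξ.ne_zero (NeZero.ne n)
  refine isYetterDrinfeld_of_generator (fun z => ?_) (fun z => ?_) (VInf_isWeight hξ i j).coact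
    (VInf_span hξ i j)
  · induction z using Finsupp.induction_linear with
    | zero => simp
    | add p q hp hq => simp only [map_add, hp, hq]
    | single a r =>
      rw [VInf_act_g, map_smul, VInf_coact, map_smul,
        sum_step_g _ h0 i j a (fun l => Finsupp.single l 1) fun l _ => VInf_act_g hξ i j l 1,
        smul_comm]
  · induction z using Finsupp.induction_linear with
    | zero => simp
    | add p q hp hq => simp only [map_add, hp, hq]
    | single a r =>
      rw [VInf_act_x, VInf_coact, VInf_coact, map_smul,
        sum_step _ i j a (fun l => Finsupp.single l 1) (fun l _ => VInf_act_g hξ i j l 1)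
          fun l _ => VInf_act_x hξ i j l 1]

/-- V(ti, j) is a Yetter–Drinfeld module, though ti is not in 𝒥, and its v_l are independent. That
x^m v_0 is a weight vector there can thus be read as the vanishing of structure constants. -/
theorem c_eq_zero_of_dvd (hξ : IsPrimitiveRoot ξ n) (i j : ℤ) {m l : ℕ} (hm : ordN t ξ ∣ m)
    (hl : l < m) :
    c n t ξ (t * i) j m l = 0 := by
  have h1 := (VInf_isWeight (t := t) hξ (t * i) j).x_pow_of_dvd
    (VInf_isYetterDrinfeld hξ (t * i) j) hξ hm
  have h2 := h1.coact
  rw [VInf_act_x_pow, VInf_coact, one_smul, add_zero] at h2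
  have h3 := congrArg (TensorProduct.rid k (Taft n t ξ) ∘
    (Finsupp.lapply (R := k) (M := k) l).lTensor (Taft n t ξ)) h2
  simp only [Function.comp_apply, map_sum, LinearMap.lTensor_tmul, TensorProduct.rid_tmul,
    Finsupp.lapply_apply] at h3
  simpa [Finsupp.single_apply, hl.ne', Nat.lt_succ_of_lt hl, hl.le] using h3

theorem alpha_ne_zero_of_mem_setJ (hξ : IsPrimitiveRoot ξ n) (i j : ℤ) (hi : i ∈ setJ n t)
    (m : ℕ) : alpha t ξ i j m 0 ≠ 0 := by
  refine alpha_zero_right_ne_zero t (hξ.ne_zero (NeZero.ne n)) i j m fun s _ h => ?_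
  rw [zpow_eq_zpow_iff hξ] at h
  have h' := h.neg.symm
  rw [neg_neg, ← mul_neg] at h'
  exact hi _ h'

theorem VInf_span_image : Submodule.span k
    ((fun m : ℕ => (VInf t hξ i j).act (x n t ξ ^ m) (Finsupp.single 0 1)) '' Set.univ) = ⊤ := by
  rw [Set.image_univ]
  exact VInf_span hξ i j

theorem VInf_isSimpleYD (hi : i ∈ setJ n t) : (VInf t hξ i j).IsSimpleYD :=
  isSimpleYD_of_alpha_ne_zero (VInf_isYetterDrinfeld hξ i j) hξ (VInf_isWeight hξ i j) (by simp)
    (VInf_span_image hξ i j) fun m _ => alpha_ne_zero_of_mem_setJ hξ i j hi m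

variable {V : Type*} [AddCommGroup V] [Module k V]

theorem VInf_iso {M : YDData k (Taft n t ξ) V} (hM : M.IsSimpleYD) (hi : i ∈ setJ n t) {z : V}
    (hz : IsWeight M i j z) (hz0 : z ≠ 0) : M.Iso (VInf t hξ i j) := by
  have h0 := hξ.ne_zero (NeZero.ne n)
  have hf : IsHom (VInf t hξ i j) M
      (Finsupp.linearCombination k fun m : ℕ => M.act (x n t ξ ^ m) z) := by
    refine isHom_of_generators (fun y => ?_) (fun y => ?_) (fun y => ?_)
    all_goals induction y using Finsupp.induction_linear with
    | zero => simp
    | add p q hp hq => simp only [map_add, hp, hq]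
    | single a r => ?_
    · rw [VInf_act_g, map_smul, Finsupp.linearCombination_single, map_smul,
        act_g_act_x_pow M h0 hz.act_g, smul_comm]
    · rw [VInf_act_x, Finsupp.linearCombination_single, Finsupp.linearCombination_single, map_smul,
        act_x_pow_succ]
    · rw [VInf_coact, Finsupp.linearCombination_single, map_smul, map_smul, map_sum,
        hz.coact_x_pow hM.isYetterDrinfeld h0]
      simp
  exact hf.iso (VInf_isSimpleYD hξ i j hi) hM (z := Finsupp.single 0 1) (by simpa using hz0)

end VInf

/-! ### The function φ and the last index -/

section Index

variable {k : Type u} [Field k] {n t : ℕ} [NeZero n] {ξ : k}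

theorem phi_pos (hξ : IsPrimitiveRoot ξ n) (a : ℤ) : 0 < phi t ξ a := by
  have := Int.emod_nonneg (a - 1) (Int.natCast_ne_zero.mpr (ordN_pos hξ t).ne')
  rw [phi]
  omega

theorem phi_le (hξ : IsPrimitiveRoot ξ n) (a : ℤ) : phi t ξ a ≤ ordN t ξ := by
  have := Int.emod_lt_of_pos (a - 1) (Int.natCast_pos.mpr (ordN_pos hξ t))
  rw [phi]
  omega

theorem phi_modEq (hξ : IsPrimitiveRoot ξ n) (a : ℤ) :
    (phi t ξ a : ℤ) ≡ a [ZMOD (ordN t ξ : ℤ)] := by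
  have := Int.emod_nonneg (a - 1) (Int.natCast_ne_zero.mpr (ordN_pos hξ t).ne')
  rw [phi, Int.toNat_of_nonneg (by omega)]
  simpa using (Int.mod_modEq (a - 1) (ordN t ξ : ℤ)).add_right 1

theorem phi_congr {a b : ℤ} (h : a ≡ b [ZMOD (ordN t ξ : ℤ)]) : phi t ξ a = phi t ξ b := by
  rw [phi, phi, h.sub_right 1]

theorem ordN_sub_phi_modEq (hξ : IsPrimitiveRoot ξ n) (i j : ℤ) :
    ((ordN t ξ - phi t ξ (-i - j) + 1 : ℕ) : ℤ) ≡ i + j + 1 [ZMOD (ordN t ξ : ℤ)] := by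
  have h := (phi_modEq (t := t) hξ (-i - j)).dvd
  rw [Int.modEq_iff_dvd]
  push_cast [phi_le hξ (-i - j)]
  have := dvd_sub (dvd_neg.mpr h) (dvd_refl (ordN t ξ : ℤ))
  rwa [show i + j + 1 - ((ordN t ξ : ℤ) - phi t ξ (-i - j) + 1) =
    -(-i - j - phi t ξ (-i - j)) - ordN t ξ by ring]

theorem lastIndex_zero (i j : ℤ) :
    lastIndex n t ξ i j 0 = ordN t ξ - phi t ξ (-i - j) := by
  simp [lastIndex]

theorem lastIndex_zero_lt (hξ : IsPrimitiveRoot ξ n) (i j : ℤ) :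
    lastIndex n t ξ i j 0 < ordN t ξ := by
  have := phi_pos (t := t) hξ (-i - j)
  have := ordN_pos hξ t
  rw [lastIndex_zero]
  omega

theorem lastIndex_add_one_of_ne (i j : ℤ) {lam : k} (h : lam ≠ 0) :
    lastIndex n t ξ i j lam + 1 = n := by
  rw [lastIndex_of_ne n t ξ i j h, Nat.sub_add_cancel (NeZero.pos n)]

theorem lastIndex_lt (hξ : IsPrimitiveRoot ξ n) (i j : ℤ) (lam : k) :
    lastIndex n t ξ i j lam < n := by
  by_cases h : lam = 0
  · subst h
    exact (lastIndex_zero_lt hξ i j).trans_le (Nat.le_of_dvd (NeZero.pos n) (ordN_dvd hξ t))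
  · have := lastIndex_add_one_of_ne (n := n) (t := t) (ξ := ξ) i j h
    omega

/-- This makes δ consistent with x v_m = λ v_0. The reasons differ: for λ = 0 the last factor of the
product vanishes, for λ ≠ 0 the index m + 1 = n is a multiple of N. -/
theorem c_lastIndex (hξ : IsPrimitiveRoot ξ n) (i j : ℤ) (lam : k) {l : ℕ}
    (hl : l ≤ lastIndex n t ξ i j lam) :
    c n t ξ (t * i) j (lastIndex n t ξ i j lam + 1) l = 0 := by
  have h0 := hξ.ne_zero (NeZero.ne n)
  by_cases h : lam = 0
  · subst h
    rw [c_eq h0, alpha_eq_zero t h0 _ _ hl, zero_smul]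
    have h1 := (ordN_sub_phi_modEq (t := t) hξ i j).dvd
    rw [← lastIndex_zero (n := n)] at h1
    rw [← mul_neg, zpow_eq_zpow_iff hξ, mul_modEq_iff hξ, Int.modEq_iff_dvd]
    rw [← dvd_neg] at h1
    push_cast at h1
    rwa [show -i - (j - lastIndex n t ξ i j 0 : ℤ) =
      -(i + j + 1 - (lastIndex n t ξ i j 0 + 1)) by ring]
  · refine c_eq_zero_of_dvd hξ i j ?_ (Nat.lt_succ_of_le hl)
    rw [lastIndex_add_one_of_ne i j h]
    exact ordN_dvd hξ t

/-- A vanishing factor at s would make N divide the difference of the last index and s, which is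
positive and less than N. -/
theorem alpha_ne_zero_of_le_lastIndex (hξ : IsPrimitiveRoot ξ n) (i j : ℤ) {m : ℕ}
    (hm : m ≤ lastIndex n t ξ i j 0) : alpha t ξ (t * i) j m 0 ≠ 0 := by
  refine alpha_zero_right_ne_zero t (hξ.ne_zero (NeZero.ne n)) _ j m fun s hs h => ?_
  rw [← mul_neg, zpow_eq_zpow_iff hξ, mul_modEq_iff hξ] at h
  have h1 := (ordN_sub_phi_modEq (t := t) hξ i j).dvd
  rw [← lastIndex_zero (n := n)] at h1
  have h2 := dvd_add h1 h.dvd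
  push_cast at h2
  rw [show i + j + 1 - (lastIndex n t ξ i j 0 + 1 : ℤ) + (-i - (j - s)) =
    -((lastIndex n t ξ i j 0 - s : ℕ) : ℤ) by push_cast [hs.le.trans hm]; ring, dvd_neg,
    Int.natCast_dvd_natCast] at h2
  have := Nat.le_of_dvd (by omega) h2
  have := lastIndex_zero_lt (t := t) hξ i j
  omega

end Index

theorem act_x_pow_comm {k : Type u} [Field k] {n t : ℕ} [NeZero n] {ξ : k} {V : Type*}
    [AddCommGroup V] [Module k V] (M : YDData k (Taft n t ξ) V) (m l : ℕ) (z : V) :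
    M.act (x n t ξ ^ m) (M.act (x n t ξ ^ l) z) = M.act (x n t ξ ^ l) (M.act (x n t ξ ^ m) z) := by
  rw [← act_x_pow_add, ← act_x_pow_add, Nat.add_comm m l]

/-! ### The modules V(ti, j, λ) -/

section VFin

variable {k : Type u} [Field k] {n t : ℕ} [NeZero n] {ξ : k} (hξ : IsPrimitiveRoot ξ n) (i j : ℤ)
  (lam : k)

theorem VFin_act_g (a : Fin (lastIndex n t ξ i j lam + 1)) (r : k) :
    (VFin t hξ i j lam).act (g n t ξ) (Finsupp.single a r) =
      ξ ^ (j - (a : ℕ)) • Finsupp.single a r := by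
  simp [VFin, gOp_single, mul_comm]

theorem VFin_act_x_of_lt (a : Fin (lastIndex n t ξ i j lam + 1)) (r : k)
    (h : (a : ℕ) < lastIndex n t ξ i j lam) :
    (VFin t hξ i j lam).act (x n t ξ) (Finsupp.single a r) =
      Finsupp.single ⟨(a : ℕ) + 1, Nat.succ_lt_succ h⟩ r := by
  simp [VFin, xOpFin, h]

theorem VFin_act_x_of_eq (a : Fin (lastIndex n t ξ i j lam + 1)) (r : k)
    (h : (a : ℕ) = lastIndex n t ξ i j lam) :
    (VFin t hξ i j lam).act (x n t ξ) (Finsupp.single a r) = Finsupp.single 0 (r * lam) := by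
  simp [VFin, xOpFin, h]

theorem VFin_act_x_pow (m : ℕ) (hm : m < lastIndex n t ξ i j lam + 1) (r : k) :
    (VFin t hξ i j lam).act (x n t ξ ^ m) (Finsupp.single 0 r) = Finsupp.single ⟨m, hm⟩ r := by
  induction m with
  | zero => simp
  | succ m ih =>
    rw [act_x_pow_succ, ih (by omega), VFin_act_x_of_lt _ _ _ _ _ _ (by simpa using hm)]

theorem VFin_act_x_pow_last (r : k) :
    (VFin t hξ i j lam).act (x n t ξ ^ (lastIndex n t ξ i j lam + 1)) (Finsupp.single 0 r) =
      lam • Finsupp.single 0 r := by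
  rw [act_x_pow_succ, VFin_act_x_pow _ _ _ _ _ (Nat.lt_succ_self _),
    VFin_act_x_of_eq _ _ _ _ _ _ rfl]
  simp [mul_comm]

theorem sum_filter_le {V : Type*} [AddCommMonoid V] (m : ℕ) (a : Fin (m + 1))
    (f : ℕ → V) : ∑ l ∈ Finset.univ.filter (fun l : Fin (m + 1) => l ≤ a), f l =
      ∑ l ∈ Finset.range ((a : ℕ) + 1), f l := by
  refine Finset.sum_nbij (fun l => (l : ℕ)) (fun l hl => ?_) (Fin.val_injective.injOn)
    (fun l hl => ?_) fun _ _ => rfl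
  · have h := (Finset.mem_filter.mp hl).2
    exact Finset.mem_range.mpr (Nat.lt_succ_of_le h)
  · have h := Finset.mem_range.mp hl
    have := a.2
    refine ⟨⟨l, by omega⟩, ?_, rfl⟩
    rw [Finset.mem_coe, Finset.mem_filter]
    exact ⟨Finset.mem_univ _, Nat.lt_succ_iff.mp h⟩

/-- Writing x^l v_0 for v_l lets `sum_step` run past the last basis vector. -/
theorem VFin_coact (a : Fin (lastIndex n t ξ i j lam + 1)) (r : k) :
    (VFin t hξ i j lam).coact (Finsupp.single a r) =
      r • ∑ l ∈ Finset.range ((a : ℕ) + 1), c n t ξ (t * i) j a l ⊗ₜ[k]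
        (VFin t hξ i j lam).act (x n t ξ ^ l) (Finsupp.single 0 1) := by
  rw [← sum_filter_le _ _ fun l => c n t ξ (t * i) j a l ⊗ₜ[k]
    (VFin t hξ i j lam).act (x n t ξ ^ l) (Finsupp.single 0 1)]
  have h : (VFin t hξ i j lam).coact (Finsupp.single a r) =
    r • ∑ l ∈ Finset.univ.filter (fun l => l ≤ a),
      c n t ξ ((t : ℤ) * i) j (a : ℕ) (l : ℕ) ⊗ₜ[k] Finsupp.single l (1 : k) := by
    simp [VFin]
  rw [h]
  congr 1
  refine Finset.sum_congr rfl fun l _ => ?_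
  rw [VFin_act_x_pow _ _ _ _ _ l.2]

theorem VFin_isWeight : IsWeight (VFin t hξ i j lam) (t * i) j (Finsupp.single 0 1) where
  coact := by simp [VFin_coact, c_zero_zero]
  act_g := by simp [VFin_act_g]

theorem VFin_span_image : Submodule.span k ((fun m : ℕ => (VFin t hξ i j lam).act (x n t ξ ^ m)
    (Finsupp.single 0 1)) '' Set.Iic (lastIndex n t ξ i j lam)) = ⊤ := by
  rw [eq_top_iff, ← Finsupp.basisSingleOne.span_eq]
  refine Submodule.span_mono ?_
  rintro _ ⟨a, rfl⟩
  refine ⟨a, Nat.lt_succ_iff.mp a.2, ?_⟩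
  simp only [VFin_act_x_pow hξ i j lam a a.2]
  simp

theorem VFin_span : Submodule.span k (Set.range fun m : ℕ => (VFin t hξ i j lam).act (x n t ξ ^ m)
    (Finsupp.single 0 1)) = ⊤ := by
  rw [eq_top_iff, ← VFin_span_image hξ i j lam]
  exact Submodule.span_mono (Set.image_subset_range _ _)

theorem VFin_isYetterDrinfeld : (VFin t hξ i j lam).IsYetterDrinfeld := by
  have h0 := hξ.ne_zero (NeZero.ne n)
  have hg := act_g_act_x_pow (VFin t hξ i j lam) h0 (VFin_isWeight hξ i j lam).act_g
  refine isYetterDrinfeld_of_generator (fun z => ?_) (fun z => ?_)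
    (VFin_isWeight hξ i j lam).coact (VFin_span hξ i j lam)
  · induction z using Finsupp.induction_linear with
    | zero => simp
    | add p q hp hq => simp only [map_add, hp, hq]
    | single a r =>
      rw [VFin_act_g, map_smul, VFin_coact, map_smul,
        sum_step_g _ h0 (t * i) j a _ fun l _ => hg l, smul_comm]
  · induction z using Finsupp.induction_linear with
    | zero => simp
    | add p q hp hq => simp only [map_add, hp, hq]
    | single a r =>
      rw [VFin_coact, map_smul,
        sum_step _ (t * i) j a _ (fun l _ => hg l) fun l _ => (act_x_pow_succ _ l _).symm]
      rcases Nat.lt_or_ge a (lastIndex n t ξ i j lam) with h | h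
      · rw [VFin_act_x_of_lt _ _ _ _ _ _ h, VFin_coact]
      · have ha : (a : ℕ) = lastIndex n t ξ i j lam := by have := a.2; omega
        -- Wrap-around: only the top term g^(ti-t(m+1)) ⊗ λ v_0 survives. If λ ≠ 0 then m + 1 = n,
        -- and the exponent reduces to ti.
        rw [VFin_act_x_of_eq _ _ _ _ _ _ ha, ha, Finset.sum_range_succ, Finset.sum_eq_zero,
          zero_add, VFin_act_x_pow_last, c_eq h0, alpha_self, VFin_coact]
        · by_cases hl : lam = 0
          · subst hl; simp
          · have e : gz n t ξ (t * i - t * (lastIndex n t ξ i j lam + 1 : ℕ)) =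
                gz n t ξ (t * i) := by
              rw [lastIndex_add_one_of_ne i j hl]
              apply gz_congr
              rw [Int.modEq_iff_dvd]
              exact ⟨t, by ring⟩
            rw [e]
            simp [c_zero_zero, mul_smul, -Finsupp.smul_single]
        · intro l hl
          rw [c_lastIndex hξ i j lam (Nat.lt_succ_iff.mp (Finset.mem_range.mp hl)),
            TensorProduct.zero_tmul]

theorem gOp_apply {α : Type} (idx : α → ℕ) (j : ℤ) (y : α →₀ k) (a : α) :
    gOp ξ idx j y a = y a * ξ ^ (j - (idx a : ℤ)) := by
  classical
  induction y using Finsupp.induction_linear with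
  | zero => simp
  | add p q hp hq => simp [hp, hq, add_mul]
  | single b r =>
    rw [gOp_single, Finsupp.single_apply, Finsupp.single_apply]
    split_ifs with h
    · rw [h]
    · simp

/-- There are at most n basis vectors, so their g-eigenvalues ξ^(j-a) are distinct. -/
theorem VFin_eq_single {y : Fin (lastIndex n t ξ i j lam + 1) →₀ k} {s : ℤ}
    (hy : (VFin t hξ i j lam).act (g n t ξ) y = ξ ^ s • y) (hy0 : y ≠ 0) :
    ∃ a, y = Finsupp.single a (y a) ∧ y a ≠ 0 := by
  have h : ∀ a, y a ≠ 0 → j - (a : ℕ) ≡ s [ZMOD (n : ℤ)] := by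
    intro a ha
    have h1 : gOp ξ (fun a : Fin (lastIndex n t ξ i j lam + 1) => (a : ℕ)) j y = ξ ^ s • y := by
      rw [← hy]; simp [VFin]
    have h2 := DFunLike.congr_fun h1 a
    rw [gOp_apply, Finsupp.smul_apply, smul_eq_mul, mul_comm] at h2
    exact (zpow_eq_zpow_iff hξ _ _).mp (mul_right_cancel₀ ha h2)
  obtain ⟨a, ha⟩ := Finsupp.ne_iff.mp hy0
  rw [Finsupp.zero_apply] at ha
  refine ⟨a, Finsupp.ext fun b => ?_, ha⟩
  by_cases hb : y b = 0
  · rw [Finsupp.single_apply]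
    split_ifs with hab
    · rw [hab]
    · exact hb
  · have h1 := ((h a ha).trans (h b hb).symm).dvd
    have h2 : (a : ℕ) ≡ b [MOD n] := by
      rw [Nat.modEq_iff_dvd]
      rwa [show j - (b : ℕ) - (j - (a : ℕ)) = -(((b : ℕ) : ℤ) - (a : ℕ)) by ring, dvd_neg] at h1
    have h3 := lastIndex_lt (t := t) hξ i j lam
    have h4 : a = b := Fin.ext (h2.eq_of_lt_of_lt (by omega) (by omega))
    rw [h4, Finsupp.single_eq_same]

theorem VFin_isSimpleYD : (VFin t hξ i j lam).IsSimpleYD := by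
  by_cases hlam : lam = 0
  · subst hlam
    exact isSimpleYD_of_alpha_ne_zero (VFin_isYetterDrinfeld hξ i j 0) hξ (VFin_isWeight hξ i j 0)
      (by simp) (VFin_span_image hξ i j 0) fun m hm => alpha_ne_zero_of_le_lastIndex hξ i j hm
  refine ⟨VFin_isYetterDrinfeld hξ i j lam, ⟨Finsupp.single 0 1, 0, by simp⟩, fun W hW => ?_⟩
  rw [or_iff_not_imp_left, Submodule.eq_bot_iff]
  intro h
  push Not at h
  obtain ⟨y, hy, hy0⟩ := h
  -- For λ ≠ 0 some structure constants may vanish, so the detecting functional is unavailable.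
  -- Instead a submodule contains a g-eigenvector, a multiple of some v_a, and x^(n-a) carries it to
  -- a non-zero multiple of v_0.
  have hT : ((VFin t hξ i j lam).act (g n t ξ)) ^ n = 1 := by
    rw [← map_pow, g_pow, map_one]
  obtain ⟨y, hy, s, hy0, hs⟩ := exists_eigenvector_of_pow_eq_one hξ hT
    (hW.act_mem (g n t ξ)) hy hy0
  obtain ⟨a, e, ha⟩ := VFin_eq_single hξ i j lam (s := s) (by simpa using hs) hy0
  have h1 : (VFin t hξ i j lam).act (x n t ξ ^ (lastIndex n t ξ i j lam + 1 - a)) y =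
      (lam * y a) • Finsupp.single 0 1 := by
    have h2 := VFin_act_x_pow hξ i j lam a a.2 (y a)
    rw [Fin.eta, ← e] at h2
    conv_lhs => rw [← h2]
    rw [← act_x_pow_add, Nat.sub_add_cancel a.2.le, VFin_act_x_pow_last]
    simp
  have h2 := hW.act_mem (x n t ξ ^ (lastIndex n t ξ i j lam + 1 - a)) y hy
  rw [h1, W.smul_mem_iff (mul_ne_zero hlam ha)] at h2
  rw [eq_top_iff, ← VFin_span hξ i j lam, Submodule.span_le]
  rintro _ ⟨m, rfl⟩
  exact hW.act_mem _ _ h2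

variable {V : Type*} [AddCommGroup V] [Module k V]

/-- The hypothesis on x^(m+1) z is what makes v_a ↦ x^a z commute with x at the last basis vector;
Schur's lemma does the rest. -/
theorem VFin_iso {M : YDData k (Taft n t ξ) V} (hM : M.IsSimpleYD) {z : V}
    (hz : IsWeight M (t * i) j z) (hz0 : z ≠ 0)
    (hlast : M.act (x n t ξ ^ (lastIndex n t ξ i j lam + 1)) z = lam • z) :
    M.Iso (VFin t hξ i j lam) := by
  have h0 := hξ.ne_zero (NeZero.ne n)
  set f : (Fin (lastIndex n t ξ i j lam + 1) →₀ k) →ₗ[k] V :=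
    Finsupp.linearCombination k fun m => M.act (x n t ξ ^ (m : ℕ)) z with hf_def
  have hf0 : ∀ l, l < lastIndex n t ξ i j lam + 1 →
      f ((VFin t hξ i j lam).act (x n t ξ ^ l) (Finsupp.single 0 1)) = M.act (x n t ξ ^ l) z := by
    intro l hl
    rw [VFin_act_x_pow _ _ _ _ _ hl, hf_def, Finsupp.linearCombination_single, one_smul]
  have hf : IsHom (VFin t hξ i j lam) M f := by
    refine isHom_of_generators (fun y => ?_) (fun y => ?_) (fun y => ?_)
    all_goals induction y using Finsupp.induction_linear with
    | zero => simp
    | add p q hp hq => simp only [map_add, hp, hq]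
    | single a r => ?_
    · rw [VFin_act_g, map_smul, hf_def, Finsupp.linearCombination_single, map_smul,
        act_g_act_x_pow M h0 hz.act_g, smul_comm]
    · rw [hf_def]
      rcases Nat.lt_or_ge a (lastIndex n t ξ i j lam) with h | h
      · rw [VFin_act_x_of_lt _ _ _ _ _ _ h, Finsupp.linearCombination_single,
          Finsupp.linearCombination_single, map_smul, act_x_pow_succ]
      · have ha : (a : ℕ) = lastIndex n t ξ i j lam := by have := a.2; omega
        rw [VFin_act_x_of_eq _ _ _ _ _ _ ha, Finsupp.linearCombination_single,
          Finsupp.linearCombination_single, map_smul, ← act_x_pow_succ, ha, hlast, mul_smul]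
        simp
    · have h1 : f (Finsupp.single a r) = r • M.act (x n t ξ ^ (a : ℕ)) z := by
        rw [hf_def, Finsupp.linearCombination_single]
      rw [VFin_coact, h1, map_smul, map_smul, map_sum, hz.coact_x_pow hM.isYetterDrinfeld h0]
      congr 1
      refine Finset.sum_congr rfl fun l hl => ?_
      rw [LinearMap.lTensor_tmul, hf0 l]
      have := Finset.mem_range.mp hl
      have := a.2
      omega
  refine hf.iso (VFin_isSimpleYD hξ i j lam) hM (z := Finsupp.single 0 1) ?_
  rw [hf_def, Finsupp.linearCombination_single]
  simpa using hz0

theorem VFin_act_x_pow_n (y : Fin (lastIndex n t ξ i j lam + 1) →₀ k) :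
    (VFin t hξ i j lam).act (x n t ξ ^ n) y = lam • y := by
  have hn := lastIndex_lt (t := t) hξ i j lam
  have h0 : (VFin t hξ i j lam).act (x n t ξ ^ n) (Finsupp.single 0 1) =
      lam • Finsupp.single 0 1 := by
    by_cases h : lam = 0
    · subst h
      have h1 := act_x_pow_add (VFin t hξ i j 0) (n - (lastIndex n t ξ i j 0 + 1))
        (lastIndex n t ξ i j 0 + 1) (Finsupp.single 0 1)
      rw [Nat.sub_add_cancel hn] at h1
      rw [h1, VFin_act_x_pow_last, zero_smul, map_zero]
    · have e : x n t ξ ^ (lastIndex n t ξ i j lam + 1) = x n t ξ ^ n :=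
        congrArg _ (lastIndex_add_one_of_ne i j h)
      rw [← e, VFin_act_x_pow_last]
  have h1 : Submodule.span k (Set.range fun m : ℕ => (VFin t hξ i j lam).act (x n t ξ ^ m)
      (Finsupp.single 0 1)) ≤
      LinearMap.eqLocus ((VFin t hξ i j lam).act (x n t ξ ^ n)) (lam • LinearMap.id) := by
    rw [Submodule.span_le]
    rintro _ ⟨m, rfl⟩
    rw [SetLike.mem_coe, LinearMap.mem_eqLocus, act_x_pow_comm, h0, map_smul]
    rfl
  rw [VFin_span] at h1
  exact h1 (x := y) trivial

end VFin

/-! ### Classification of the simple modules -/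

section Classification

variable {k : Type u} [Field k] {n t : ℕ} [NeZero n] {ξ : k}
variable {V : Type*} [AddCommGroup V] [Module k V]

theorem exists_isWeight {M : YDData k (Taft n t ξ) V} (hM : M.IsYetterDrinfeld)
    (hξ : IsPrimitiveRoot ξ n) [Nontrivial V] : ∃ (i j : ℤ) (z : V), z ≠ 0 ∧ IsWeight M i j z := by
  obtain ⟨z, i, hz0, hz⟩ := exists_grouplike hM hξ
  have hT : M.act (g n t ξ) ^ n = 1 := by rw [← map_pow, g_pow, map_one]
  let U : Submodule k V := LinearMap.eqLocus M.coact (TensorProduct.mk k _ V (gz n t ξ i))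
  have hU : ∀ y ∈ U, M.act (g n t ξ) y ∈ U := by
    intro y hy
    have hy' : M.coact y = gz n t ξ i ⊗ₜ[k] y := hy
    change M.coact (M.act (g n t ξ) y) = gz n t ξ i ⊗ₜ[k] M.act (g n t ξ) y
    rw [hM.compat_comul₂, hy', twist_comul₂_g]
    congr 1
    rw [← gz_one, ← gz_add, ← gz_add]
    congr 1
    ring
  obtain ⟨y, hy, j, hy0, hj⟩ := exists_eigenvector_of_pow_eq_one hξ hT hU (show z ∈ U from hz) hz0
  exact ⟨i, j, y, hy0, hy, by simpa using hj⟩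

/-- The space of the weight vectors of a given weight. -/
def weightSpace (M : YDData k (Taft n t ξ) V) (i j : ℤ) : Submodule k V :=
  LinearMap.eqLocus M.coact (TensorProduct.mk k _ V (gz n t ξ i)) ⊓
    LinearMap.eqLocus (M.act (g n t ξ)) (ξ ^ j • LinearMap.id)

theorem mem_weightSpace {M : YDData k (Taft n t ξ) V} {i j : ℤ} {z : V} :
    z ∈ weightSpace M i j ↔ IsWeight M i j z :=
  ⟨fun h => ⟨h.1, h.2⟩, fun h => ⟨h.coact, h.act_g⟩⟩

/-- Since N divides n, the operator x^n preserves each weight space with first index in tℤ. -/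
theorem exists_eigenvector_x_pow [IsAlgClosed k] [FiniteDimensional k V]
    {M : YDData k (Taft n t ξ) V} (hM : M.IsYetterDrinfeld) (hξ : IsPrimitiveRoot ξ n) {i j : ℤ}
    {z : V} (hz : IsWeight M (t * i) j z) (hz0 : z ≠ 0) :
    ∃ (y : V) (lam : k), y ≠ 0 ∧ IsWeight M (t * i) j y ∧ M.act (x n t ξ ^ n) y = lam • y := by
  have hmap : ∀ y ∈ weightSpace M (t * i) j, M.act (x n t ξ ^ n) y ∈ weightSpace M (t * i) j := by
    intro y hy
    rw [mem_weightSpace] at hy ⊢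
    refine (hy.x_pow_of_dvd hM hξ (ordN_dvd hξ t)).congr hξ (Int.ModEq.refl _) ?_
    rw [Int.modEq_iff_dvd]
    exact ⟨1, by ring⟩
  have : Nontrivial (weightSpace M (t * i) j) :=
    ⟨⟨z, mem_weightSpace.mpr hz⟩, 0, fun h => hz0 (congrArg Subtype.val h)⟩
  obtain ⟨lam, hlam⟩ := Module.End.exists_eigenvalue ((M.act (x n t ξ ^ n)).restrict hmap)
  obtain ⟨y, hy⟩ := hlam.exists_hasEigenvector
  refine ⟨y, lam, fun h => hy.2 (Subtype.ext h), mem_weightSpace.mp y.2, ?_⟩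
  exact congrArg Subtype.val hy.apply_eq_smul

theorem IsWeight.cyclic_eq_top {M : YDData k (Taft n t ξ) V} (hM : M.IsSimpleYD)
    (hξ : IsPrimitiveRoot ξ n) {i j : ℤ} {z : V} (hz : IsWeight M i j z) (hz0 : z ≠ 0) :
    cyclic M z = ⊤ := by
  refine (hM.eq_bot_or_eq_top _ (hz.isSub_cyclic hM.isYetterDrinfeld
    (hξ.ne_zero (NeZero.ne n)))).resolve_left fun h => hz0 ?_
  have := mem_cyclic M z
  rwa [h] at this

/-- Expressing z through the x^m x^p z with top index K gives a relation that puts x^(K+p) z in the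
span of the lower powers, which is then x-stable. -/
theorem finiteDimensional_of_mem_cyclic {M : YDData k (Taft n t ξ) V} {z : V}
    (hz : cyclic M z = ⊤) {p : ℕ} (hp : 0 < p) (h : cyclic M (M.act (x n t ξ ^ p) z) = ⊤) :
    FiniteDimensional k V := by
  by_cases hz0 : z = 0
  · subst hz0
    have : (⊤ : Submodule k V) = ⊥ := by
      rw [← hz, cyclic]
      simp
    exact Module.finite_def.mpr (this ▸ Submodule.fg_bot)
  have hspan : Submodule.span k ((fun m => M.act (x n t ξ ^ m) (M.act (x n t ξ ^ p) z)) ''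
      Set.univ) = ⊤ := by rw [Set.image_univ]; exact h
  obtain ⟨a, K, -, haK, hK, e⟩ := exists_linearCombination hspan hz0
  let W : Submodule k V :=
    Submodule.span k ((fun m => M.act (x n t ξ ^ m) z) '' (Set.Iio (K + p)))
  have hmem : ∀ m < K + p, M.act (x n t ξ ^ m) z ∈ W := fun m hm =>
    Submodule.subset_span ⟨m, hm, rfl⟩
  have hzW : z ∈ W := by simpa using hmem 0 (by omega)
  have hlast : M.act (x n t ξ ^ (K + p)) z ∈ W := by
    rw [Finsupp.linearCombination_apply, Finsupp.sum,
      ← Finset.add_sum_erase _ _ (Finsupp.mem_support_iff.mpr haK)] at e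
    rw [act_x_pow_add, ← W.smul_mem_iff haK, eq_sub_of_add_eq e]
    refine W.sub_mem hzW (W.sum_mem fun m hm => W.smul_mem _ ?_)
    rw [← act_x_pow_add]
    have h1 := Finset.mem_erase.mp hm
    have h2 := hK m h1.2
    have h3 := h1.1
    exact hmem _ (by omega)
  have hW : W = ⊤ := by
    rw [eq_top_iff, ← hz]
    refine span_le_of_x_stable hzW fun y hy => ?_
    have : W ≤ W.comap (M.act (x n t ξ)) := by
      refine Submodule.span_le.mpr ?_
      rintro _ ⟨m, hm, rfl⟩
      rw [SetLike.mem_coe, Submodule.mem_comap, ← act_x_pow_succ]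
      rcases Nat.lt_or_ge (m + 1) (K + p) with h1 | h1
      · exact hmem _ h1
      · rwa [show m + 1 = K + p by have := Set.mem_Iio.mp hm; omega]
    exact this hy
  exact Module.finite_def.mpr (hW ▸ Submodule.fg_span ((Set.finite_Iio _).image _))

theorem iso_or_cyclic_eq_top {M : YDData k (Taft n t ξ) V} (hM : M.IsSimpleYD)
    (hξ : IsPrimitiveRoot ξ n) {i j : ℤ} {z : V} (hz : IsWeight M (t * i) j z) (hz0 : z ≠ 0) :
    M.Iso (VFin t hξ i j 0) ∨
      cyclic M (M.act (x n t ξ ^ (lastIndex n t ξ i j 0 + 1)) z) = ⊤ := by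
  by_cases h : M.act (x n t ξ ^ (lastIndex n t ξ i j 0 + 1)) z = 0
  · left
    exact VFin_iso hξ i j 0 hM hz hz0 (by rw [h, zero_smul])
  · right
    refine (hz.x_pow_of_modEq hM.isYetterDrinfeld hξ (Nat.succ_pos _) ?_).cyclic_eq_top hM hξ h
    rw [lastIndex_zero]
    exact ordN_sub_phi_modEq hξ i j

theorem exists_mul_of_notMem_setJ {i : ℤ} (hi : i ∉ setJ n t) :
    ∃ r : ℤ, i ≡ t * r [ZMOD (n : ℤ)] := by
  simpa [setJ] using hi

theorem not_finite_nat_finsupp : ¬ FiniteDimensional k (ℕ →₀ k) := fun _ => by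
  have := Module.Finite.finite_basis (Finsupp.basisSingleOne (R := k) (ι := ℕ))
  exact not_finite ℕ

theorem exists_iso_VFin [IsAlgClosed k] [FiniteDimensional k V] {M : YDData k (Taft n t ξ) V}
    (hM : M.IsSimpleYD) (hξ : IsPrimitiveRoot ξ n) :
    ∃ (i j : ℤ) (lam : k), M.Iso (VFin t hξ i j lam) := by
  have := hM.nontrivial
  obtain ⟨i, j, z, hz0, hz⟩ := exists_isWeight hM.isYetterDrinfeld hξ
  by_cases hi : i ∈ setJ n t
  · obtain ⟨e, -⟩ := VInf_iso hξ i j hM hi hz hz0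
    exact absurd (LinearEquiv.finiteDimensional e) not_finite_nat_finsupp
  obtain ⟨r, hr⟩ := exists_mul_of_notMem_setJ hi
  obtain ⟨y, lam, hy0, hy, hlam⟩ := exists_eigenvector_x_pow hM.isYetterDrinfeld hξ
    (hz.congr hξ hr (Int.ModEq.refl j)) hz0
  by_cases h : lam = 0
  · subst h
    refine ⟨r, j, 0, (iso_or_cyclic_eq_top hM hξ hy hy0).resolve_right fun h => hy0 ?_⟩
    -- If x^p y generates the module with p > 0, then x is surjective, and so is x^n; but x^n y = 0
    -- makes x^n vanish on the whole module.
    have hsurj : Function.Surjective (M.act (x n t ξ)) := by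
      rw [← LinearMap.range_eq_top, eq_top_iff, ← h]
      refine Submodule.span_le.mpr ?_
      rintro _ ⟨m, rfl⟩
      exact ⟨M.act (x n t ξ ^ (m + lastIndex n t ξ r j 0)) y, by
        rw [← act_x_pow_succ, add_assoc, act_x_pow_add]⟩
    have hzero : cyclic M y ≤ LinearMap.ker (M.act (x n t ξ ^ n)) := by
      refine Submodule.span_le.mpr ?_
      rintro _ ⟨m, rfl⟩
      rw [SetLike.mem_coe, LinearMap.mem_ker, act_x_pow_comm, hlam, zero_smul, map_zero]
    rw [hy.cyclic_eq_top hM hξ hy0, top_le_iff] at hzero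
    have hs : Function.Surjective (M.act (x n t ξ ^ n)) := by
      rw [map_pow, Module.End.coe_pow]
      exact hsurj.iterate n
    obtain ⟨w, rfl⟩ := hs y
    rw [LinearMap.ker_eq_top.mp hzero, LinearMap.zero_apply]
  · refine ⟨r, j, lam, VFin_iso hξ r j lam hM hy hy0 ?_⟩
    have e : x n t ξ ^ (lastIndex n t ξ r j lam + 1) = x n t ξ ^ n :=
      congrArg _ (lastIndex_add_one_of_ne r j h)
    rw [e, hlam]

theorem exists_iso_VInf {M : YDData k (Taft n t ξ) V} (hM : M.IsSimpleYD)
    (hV : ¬ FiniteDimensional k V) (hξ : IsPrimitiveRoot ξ n) :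
    ∃ i ∈ setJ n t, ∃ j : ℤ, M.Iso (VInf t hξ i j) := by
  have := hM.nontrivial
  obtain ⟨i, j, z, hz0, hz⟩ := exists_isWeight hM.isYetterDrinfeld hξ
  by_cases hi : i ∈ setJ n t
  · exact ⟨i, hi, j, VInf_iso hξ i j hM hi hz hz0⟩
  obtain ⟨r, hr⟩ := exists_mul_of_notMem_setJ hi
  have hz' := hz.congr hξ hr (Int.ModEq.refl j)
  rcases iso_or_cyclic_eq_top hM hξ hz' hz0 with ⟨e, -⟩ | h
  · exact absurd (LinearEquiv.finiteDimensional e.symm) hV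
  · exact absurd (finiteDimensional_of_mem_cyclic (hz.cyclic_eq_top hM hξ hz0) (Nat.succ_pos _) h)
      hV

/-- If t is invertible mod n every residue is a multiple of t; otherwise 1 is not. -/
theorem setJ_nonempty_iff : (setJ n t).Nonempty ↔ ¬ Nat.Coprime t n := by
  constructor
  · rintro ⟨i, hi⟩ h
    have h1 := Nat.isCoprime_iff_coprime.mpr h
    obtain ⟨a, b, hab⟩ := h1
    refine hi (a * i) ?_
    rw [Int.modEq_iff_dvd]
    refine ⟨-(b * i), ?_⟩
    linear_combination i * hab
  · intro h
    refine ⟨1, fun m hm => h ?_⟩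
    obtain ⟨b, hb⟩ := hm.dvd
    rw [← Nat.isCoprime_iff_coprime]
    exact ⟨m, -b, by linear_combination hb⟩

end Classification

/-! ### Isomorphisms between the modules -/

section Isomorphisms

variable {k : Type u} [Field k] {n t : ℕ} [NeZero n] {ξ : k} (hξ : IsPrimitiveRoot ξ n)

theorem eq_of_VFin_iso (i j r s : ℤ) (lam mu : k)
    (h : (VFin t hξ i j lam).Iso (VFin t hξ r s mu)) : lam = mu := by
  obtain ⟨e, he, -⟩ := h
  have h1 := he (x n t ξ ^ n) (Finsupp.single 0 1)
  rw [VFin_act_x_pow_n, VFin_act_x_pow_n, map_smul] at h1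
  refine smul_left_injective k ?_ h1
  rw [Ne, LinearEquiv.map_eq_zero_iff]
  simp

theorem VFin_zero_iso_iff (i j r s : ℤ) :
    (VFin t hξ i j 0).Iso (VFin t hξ r s 0) ↔
      i ≡ r [ZMOD (ordN t ξ : ℤ)] ∧ j ≡ s [ZMOD (n : ℤ)] := by
  constructor
  · intro h
    obtain ⟨f, hf, hinj⟩ := h.exists_isHom
    have h1 := (VFin_isWeight (t := t) hξ r s 0).map hf
    have h0 : f (Finsupp.single 0 1) ≠ 0 := by
      rw [Ne, map_eq_zero_iff _ hinj.1]
      simp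
    obtain ⟨b, hb⟩ := eq_smul_of_grouplike (VFin_isYetterDrinfeld hξ i j 0) hξ
      (VFin_isWeight hξ i j 0) (by simp) (VFin_span_image hξ i j 0)
      (fun m hm => alpha_ne_zero_of_le_lastIndex hξ i j hm) h1.coact
    have h2 := (VFin_isWeight (t := t) hξ i j 0).smul b
    rw [← hb] at h2
    obtain ⟨h3, h4⟩ := h2.modEq hξ h0 h1
    exact ⟨(mul_modEq_iff hξ t i r).mp h3, h4⟩
  · rintro ⟨hi, hj⟩
    have hN : (ordN t ξ : ℤ) ∣ n := Int.natCast_dvd_natCast.mpr (ordN_dvd hξ t)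
    refine VFin_iso hξ r s 0 (VFin_isSimpleYD hξ i j 0) (z := Finsupp.single 0 1)
      ((VFin_isWeight hξ i j 0).congr hξ ((mul_modEq_iff hξ t i r).mpr hi) hj) (by simp) ?_
    have e : lastIndex n t ξ r s 0 = lastIndex n t ξ i j 0 := by
      rw [lastIndex_zero, lastIndex_zero, phi_congr ((hi.neg).sub (hj.of_dvd hN))]
    have e' : x n t ξ ^ (lastIndex n t ξ r s 0 + 1) = x n t ξ ^ (lastIndex n t ξ i j 0 + 1) := by
      rw [e]
    rw [e', VFin_act_x_pow_last]

theorem exists_of_VFin_iso {i j r s : ℤ} {lam : k}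
    (h : (VFin t hξ i j lam).Iso (VFin t hξ r s lam)) :
    ∃ m : ℕ, (m : ℤ) ≡ i - r [ZMOD (ordN t ξ : ℤ)] ∧ (m : ℤ) ≡ j - s [ZMOD (ordN t ξ : ℤ)] ∧
      ((m : ℤ) ≡ 0 [ZMOD (ordN t ξ : ℤ)] ∨ (m : ℤ) ≡ i + j + 1 [ZMOD (ordN t ξ : ℤ)]) := by
  have hξ0 := hξ.ne_zero (NeZero.ne n)
  have hN : (ordN t ξ : ℤ) ∣ n := Int.natCast_dvd_natCast.mpr (ordN_dvd hξ t)
  obtain ⟨f, hf, hinj⟩ := h.exists_isHom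
  have h1 := (VFin_isWeight (t := t) hξ r s lam).map hf
  have h0 : f (Finsupp.single 0 1) ≠ 0 := by
    rw [Ne, map_eq_zero_iff _ hinj.1]
    simp
  -- The image of the generator is a g-eigenvector, hence a multiple of some v_a. After scaling, v_a
  -- itself has weight (tr, s), so the coefficients of δ(v_a) at v_l with l < a vanish.
  obtain ⟨a, ha, ha0⟩ := VFin_eq_single hξ i j lam h1.act_g h0
  have h2 := h1.smul (f (Finsupp.single 0 1) a)⁻¹
  rw [ha] at h2
  simp only [Finsupp.single_eq_same, Finsupp.smul_single, smul_eq_mul, inv_mul_cancel₀ ha0] at h2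
  have hc : ∀ l : Fin (lastIndex n t ξ i j lam + 1), (l : ℕ) < a →
      c n t ξ (t * i) j a l = 0 := by
    intro l hl
    have h3 := h2.coact
    rw [VFin_coact, one_smul] at h3
    have h4 := congrArg (TensorProduct.rid k (Taft n t ξ) ∘
      (Finsupp.lapply (R := k) (M := k) l).lTensor (Taft n t ξ)) h3
    simp only [Function.comp_apply, map_sum, LinearMap.lTensor_tmul, TensorProduct.rid_tmul,
      Finsupp.lapply_apply] at h4
    have h5 : ∀ m ∈ Finset.range ((a : ℕ) + 1), ((VFin t hξ i j lam).act (x n t ξ ^ m)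
        (Finsupp.single 0 1)) l • c n t ξ (t * i) j a m =
        if m = (l : ℕ) then c n t ξ (t * i) j a l else 0 := by
      intro m hm
      have hm' := Finset.mem_range.mp hm
      have ha' := a.2
      rw [VFin_act_x_pow _ _ _ _ m (by omega), Finsupp.single_apply]
      by_cases hml : m = l
      · subst hml; simp
      · rw [if_neg fun h => hml (congrArg Fin.val h), if_neg hml, zero_smul]
    rw [Finset.sum_congr rfl h5, Finset.sum_ite_eq', if_pos (Finset.mem_range.mpr (by omega)),
      Finsupp.single_apply, if_neg (by rintro rfl; omega), zero_smul] at h4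
    exact h4
  have hw : IsWeight (VFin t hξ i j lam) (t * i - t * (a : ℕ)) (j - (a : ℕ))
      (Finsupp.single a 1) := by
    have h3 := (VFin_isWeight (t := t) hξ i j lam).x_pow (VFin_isYetterDrinfeld hξ i j lam) hξ0
      (p := a) fun l hl => hc ⟨l, hl.trans a.2⟩ hl
    rwa [VFin_act_x_pow _ _ _ _ _ a.2] at h3
  obtain ⟨h3, h4⟩ := hw.modEq hξ (by simp) h2
  rw [← mul_sub, mul_modEq_iff hξ] at h3
  refine ⟨a, ?_, ?_, ?_⟩
  · have := (Int.ModEq.refl i).sub h3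
    rwa [sub_sub_cancel] at this
  · have := (Int.ModEq.refl j).sub (h4.of_dvd hN)
    rwa [sub_sub_cancel] at this
  · rcases Nat.eq_zero_or_pos a with h5 | h5
    · left; rw [h5]; rfl
    obtain ⟨p, hp⟩ := Nat.exists_eq_succ_of_ne_zero h5.ne'
    -- The coefficient just below the diagonal suffices: its vanishing gives one of the two
    -- congruences for a.
    have h6 : c n t ξ (t * i) j a p = 0 :=
      hc ⟨p, by have := a.2; omega⟩ (by simp only; omega)
    rw [hp] at h6
    rcases eq_of_alpha_succ_self_eq_zero t hξ0 _ _ (alpha_eq_zero_of_c_eq_zero hξ t _ _ h6) with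
      h7 | h7
    · left
      rw [hp, Int.modEq_zero_iff_dvd, Int.natCast_dvd_natCast]
      exact orderOf_dvd_of_pow_eq_one h7
    · right
      rw [← mul_neg, zpow_eq_zpow_iff hξ, mul_modEq_iff hξ] at h7
      have h8 := ((Int.ModEq.refl (j + 1)).sub h7).symm
      rw [hp]
      push_cast
      rw [show i + j + 1 = j + 1 - -i by ring]
      rw [show j + 1 - (j - (p : ℤ)) = p + 1 by ring] at h8
      exact h8.symm

theorem VFin_iso_of_isWeight {i j r s : ℤ} {lam : k} (hlam : lam ≠ 0) (m : ℕ)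
    (hm : (m : ℤ) ≡ j - s [ZMOD (n : ℤ)])
    (h : IsWeight (VFin t hξ i j lam) (t * r) (j - m)
      ((VFin t hξ i j lam).act (x n t ξ ^ m) (Finsupp.single 0 1))) :
    (VFin t hξ i j lam).Iso (VFin t hξ r s lam) := by
  have hs : j - (m : ℤ) ≡ s [ZMOD (n : ℤ)] := by
    have := (Int.ModEq.refl j).sub hm
    rwa [sub_sub_cancel] at this
  refine VFin_iso hξ r s lam (VFin_isSimpleYD hξ i j lam)
    (h.congr hξ (Int.ModEq.refl _) hs) ?_ ?_
  · intro h0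
    -- x^m v_0 is non-zero because a further power of x takes it to x^(nm) v_0 = λ^m v_0; m may
    -- exceed n.
    have h1 : m ≤ n * m := Nat.le_mul_of_pos_left m (NeZero.pos n)
    have h2 := act_x_pow_add (VFin t hξ i j lam) (n * m - m) m (Finsupp.single 0 1)
    rw [h0, Nat.sub_add_cancel h1, map_zero] at h2
    have h3 : ∀ q : ℕ, (VFin t hξ i j lam).act (x n t ξ ^ (n * q)) (Finsupp.single 0 1) =
        lam ^ q • Finsupp.single 0 1 := by
      intro q
      induction q with
      | zero => simp
      | succ q ih =>
        rw [Nat.mul_succ, act_x_pow_add, VFin_act_x_pow_n, map_smul, ih, smul_smul, pow_succ']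
    rw [h3] at h2
    simp [hlam] at h2
  · have e : x n t ξ ^ (lastIndex n t ξ r s lam + 1) = x n t ξ ^ n :=
      congrArg _ (lastIndex_add_one_of_ne r s hlam)
    rw [e, VFin_act_x_pow_n]

theorem VFin_iso_iff (i j r s : ℤ) {lam : k} (hlam : lam ≠ 0) :
    (VFin t hξ i j lam).Iso (VFin t hξ r s lam) ↔
      (i ≡ r [ZMOD (ordN t ξ : ℤ)] ∧ j ≡ s [ZMOD (ordN t ξ : ℤ)]) ∨
      (r ≡ i - (i + j + 1) [ZMOD (ordN t ξ : ℤ)] ∧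
        s ≡ j - (i + j + 1) [ZMOD (ordN t ξ : ℤ)]) := by
  have hN : (ordN t ξ : ℤ) ∣ n := Int.natCast_dvd_natCast.mpr (ordN_dvd hξ t)
  have key : ∀ {a b m e : ℤ}, m ≡ a - b [ZMOD (ordN t ξ : ℤ)] → m ≡ e [ZMOD (ordN t ξ : ℤ)] →
      b ≡ a - e [ZMOD (ordN t ξ : ℤ)] := by
    intro a b m e h1 h2
    have := (Int.ModEq.refl a).sub (h1.symm.trans h2)
    rwa [sub_sub_cancel] at this
  constructor
  · intro h
    obtain ⟨m, h1, h2, h3 | h3⟩ := exists_of_VFin_iso hξ h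
    · left
      have e1 := key h1 h3
      have e2 := key h2 h3
      rw [sub_zero] at e1 e2
      exact ⟨e1.symm, e2.symm⟩
    · exact Or.inr ⟨key h1 h3, key h2 h3⟩
  · intro h
    have hn0 : (n : ℤ) ≠ 0 := Int.natCast_ne_zero.mpr (NeZero.ne n)
    have hw := VFin_isWeight (t := t) hξ i j lam
    have hYD := VFin_isYetterDrinfeld (t := t) hξ i j lam
    -- Adding n keeps the residue and makes m positive, as `x_pow_of_modEq` requires.
    obtain ⟨m, hm0, hm⟩ : ∃ m : ℕ, 0 < m ∧ (m : ℤ) ≡ j - s [ZMOD (n : ℤ)] := by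
      refine ⟨((j - s) % n).toNat + n, by have := NeZero.pos n; omega, ?_⟩
      push_cast
      rw [Int.toNat_of_nonneg (Int.emod_nonneg _ hn0)]
      simpa using Int.mod_modEq (j - s) n
    have hmN := hm.of_dvd hN
    rcases h with ⟨h1, h2⟩ | ⟨h1, h2⟩
    · refine VFin_iso_of_isWeight hξ hlam m hm ?_
      refine (hw.x_pow_of_dvd hYD hξ ?_).congr hξ ((mul_modEq_iff hξ t i r).mpr h1)
        (Int.ModEq.refl _)
      rw [← Int.natCast_dvd_natCast, ← Int.modEq_zero_iff_dvd]
      have := hmN.trans (h2.sub_right s)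
      rwa [sub_self] at this
    · have hp : (m : ℤ) ≡ i + j + 1 [ZMOD (ordN t ξ : ℤ)] := by
        have := hmN.trans ((Int.ModEq.refl j).sub h2)
        rwa [sub_sub_cancel] at this
      refine VFin_iso_of_isWeight hξ hlam m hm ?_
      refine (hw.x_pow_of_modEq hYD hξ hm0 hp).congr hξ ((mul_modEq_iff hξ t _ r).mpr ?_)
        (Int.ModEq.refl _)
      exact ((Int.ModEq.refl i).sub hp).trans h1.symm

theorem VInf_iso_iff {i r : ℤ} (hi : i ∈ setJ n t) (hr : r ∈ setJ n t) (j s : ℤ) :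
    (VInf t hξ i j).Iso (VInf t hξ r s) ↔ i ≡ r [ZMOD (n : ℤ)] ∧ j ≡ s [ZMOD (n : ℤ)] := by
  constructor
  · intro h
    obtain ⟨f, hf, hinj⟩ := h.exists_isHom
    have h1 := (VInf_isWeight (t := t) hξ r s).map hf
    have h0 : f (Finsupp.single 0 1) ≠ 0 := by
      rw [Ne, map_eq_zero_iff _ hinj.1]
      simp
    obtain ⟨b, hb⟩ := eq_smul_of_grouplike (VInf_isYetterDrinfeld hξ i j) hξ
      (VInf_isWeight hξ i j) (by simp) (VInf_span_image hξ i j)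
      (fun m _ => alpha_ne_zero_of_mem_setJ hξ i j hi m) h1.coact
    have h2 := (VInf_isWeight (t := t) hξ i j).smul b
    rw [← hb] at h2
    exact h2.modEq hξ h0 h1
  · rintro ⟨h1, h2⟩
    exact VInf_iso hξ r s (VInf_isSimpleYD hξ i j hi) hr ((VInf_isWeight hξ i j).congr hξ h1 h2)
      (by simp)

end Isomorphisms

end InfTaft

end

/-! ### The classification theorem -/

theorem theorem4p19 {k : Type u} [Field k] [IsAlgClosed k] [CharZero k]
    (n t : ℕ) [NeZero n] (hn : 2 ≤ n) (ht : t < n) (ξ : k) (hξ : IsPrimitiveRoot ξ n) :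
    -- (1) the finite-dimensional simple Yetter-Drinfeld modules
    (∀ (i j : ℤ) (lam : k), (InfTaft.VFin t hξ i j lam).IsSimpleYD) ∧
    (∀ (V : Type v) [AddCommGroup V] [Module k V] (M : YDData k (InfTaft.Taft n t ξ) V),
      M.IsSimpleYD → FiniteDimensional k V →
        ∃ (i j : ℤ) (lam : k), M.Iso (InfTaft.VFin t hξ i j lam)) ∧
    -- (2) the infinite-dimensional simple Yetter-Drinfeld modules
    ((∃ (V : Type u) (_ : AddCommGroup V) (_ : Module k V) (M : YDData k (InfTaft.Taft n t ξ) V),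
        M.IsSimpleYD ∧ ¬ FiniteDimensional k V) ↔ ¬ Nat.Coprime t n) ∧
    (∀ i ∈ InfTaft.setJ n t, ∀ j : ℤ, (InfTaft.VInf t hξ i j).IsSimpleYD) ∧
    (∀ (V : Type v) [AddCommGroup V] [Module k V] (M : YDData k (InfTaft.Taft n t ξ) V),
      M.IsSimpleYD → ¬ FiniteDimensional k V →
        ∃ i ∈ InfTaft.setJ n t, ∃ j : ℤ, M.Iso (InfTaft.VInf t hξ i j)) ∧
    -- (3) the isomorphisms between these modules
    (∀ (i j r s : ℤ) (lam mu : k),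
      (InfTaft.VFin t hξ i j lam).Iso (InfTaft.VFin t hξ r s mu) → lam = mu) ∧
    (∀ i j r s : ℤ, (InfTaft.VFin t hξ i j 0).Iso (InfTaft.VFin t hξ r s 0) ↔
      i ≡ r [ZMOD (InfTaft.ordN t ξ : ℤ)] ∧ j ≡ s [ZMOD (n : ℤ)]) ∧
    (∀ (i j r s : ℤ) (lam : k) (p : ℕ), lam ≠ 0 →
      p = InfTaft.ordN t ξ - InfTaft.phi t ξ (-i - j) + 1 →
      (p = InfTaft.ordN t ξ →
        ((InfTaft.VFin t hξ i j lam).Iso (InfTaft.VFin t hξ r s lam) ↔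
          i ≡ r [ZMOD (InfTaft.ordN t ξ : ℤ)] ∧ j ≡ s [ZMOD (InfTaft.ordN t ξ : ℤ)])) ∧
      (p < InfTaft.ordN t ξ →
        ((InfTaft.VFin t hξ i j lam).Iso (InfTaft.VFin t hξ r s lam) ↔
          (i ≡ r [ZMOD (InfTaft.ordN t ξ : ℤ)] ∧ j ≡ s [ZMOD (InfTaft.ordN t ξ : ℤ)]) ∨
          (r ≡ i - p [ZMOD (InfTaft.ordN t ξ : ℤ)] ∧
            s ≡ j - p [ZMOD (InfTaft.ordN t ξ : ℤ)])))) ∧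
    (∀ i ∈ InfTaft.setJ n t, ∀ r ∈ InfTaft.setJ n t, ∀ j s : ℤ,
      (InfTaft.VInf t hξ i j).Iso (InfTaft.VInf t hξ r s) ↔
        i ≡ r [ZMOD (n : ℤ)] ∧ j ≡ s [ZMOD (n : ℤ)]) := by
  refine ⟨fun i j lam => InfTaft.VFin_isSimpleYD hξ i j lam,
    fun V _ _ M hM _ => InfTaft.exists_iso_VFin hM hξ, ?_,
    fun i hi j => InfTaft.VInf_isSimpleYD hξ i j hi,
    fun V _ _ M hM hV => InfTaft.exists_iso_VInf hM hV hξ,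
    InfTaft.eq_of_VFin_iso hξ, InfTaft.VFin_zero_iso_iff hξ, ?_,
    fun i hi r hr => InfTaft.VInf_iso_iff hξ hi hr⟩
  · rw [← InfTaft.setJ_nonempty_iff]
    constructor
    · rintro ⟨V, _, _, M, hM, hV⟩
      obtain ⟨i, hi, -⟩ := InfTaft.exists_iso_VInf hM hV hξ
      exact ⟨i, hi⟩
    · rintro ⟨i, hi⟩
      exact ⟨ℕ →₀ k, inferInstance, inferInstance, InfTaft.VInf t hξ i 0,
        InfTaft.VInf_isSimpleYD hξ i 0 hi, InfTaft.not_finite_nat_finsupp⟩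
  · intro i j r s lam p hlam hp
    have hpN : (p : ℤ) ≡ i + j + 1 [ZMOD (InfTaft.ordN t ξ : ℤ)] := by
      rw [hp]
      exact InfTaft.ordN_sub_phi_modEq hξ i j
    have key : (InfTaft.VFin t hξ i j lam).Iso (InfTaft.VFin t hξ r s lam) ↔
        (i ≡ r [ZMOD (InfTaft.ordN t ξ : ℤ)] ∧ j ≡ s [ZMOD (InfTaft.ordN t ξ : ℤ)]) ∨
        (r ≡ i - p [ZMOD (InfTaft.ordN t ξ : ℤ)] ∧ s ≡ j - p [ZMOD (InfTaft.ordN t ξ : ℤ)]) := by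
      rw [InfTaft.VFin_iso_iff hξ i j r s hlam]
      have e1 := (Int.ModEq.refl i).sub hpN
      have e2 := (Int.ModEq.refl j).sub hpN
      exact or_congr Iff.rfl (and_congr ⟨fun h => h.trans e1.symm, fun h => h.trans e1⟩
        ⟨fun h => h.trans e2.symm, fun h => h.trans e2⟩)
    refine ⟨fun h => ?_, fun _ => key⟩
    -- For p = N, subtracting p changes nothing mod N, so the second alternative is contained in the
    -- first.
    rw [key, or_iff_left_of_imp]
    rintro ⟨h1, h2⟩
    rw [h] at h1 h2
    exact ⟨Int.sub_modulus_modEq_iff.mp h1.symm, Int.sub_modulus_modEq_iff.mp h2.symm⟩
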